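/- **Setting.** Let $S$ be a compact connected orientable surface of genus $g$ with $b\ge 1$ boundary components, drawn in the plane as follows. If $g=0$, $S$ is the closed unit disk with $b-1$ disjoint open round disks removed (with disjoint closures inside the open unit disk). If $g>0$, $S$ is a punctured fundamental polygon: a regular $4g$-gon with $b$ such disks removed from its interior, whose sides are glued in pairs, reversing their counterclockwise directions, so that all corners become one point. A *directed network* $N=(V,E)$ on $S$ is a finite directed graph embedded in $S$; its edges are smooth curves with nowhere zero derivative, whose points other than their endpoints are interior points of $S$. Vertices do not lie on the sides of the polygon, edges cross the sides transversally and not at the corners, edges are not tangent to $\partial S$, and an edge entering a vertex and an edge leaving it do not form a cusp there. Let $K\subseteq V$ be the set of vertices on $\partial S$ and $I\subseteq K$ the set of those that are sources. $N$ is *perfectly oriented* if every $v\in K$ is a univalent source or sink and every $v\in V\setminus K$ is trivalent and neither a source nor a sink. Choose $b-1$ disjoint smooth simple cuts in $S$ between pairs of distinct boundary components, such that the cut surface $T$ has a single boundary component. The cuts avoid the vertices of $N$ and are transversal to the edges, to $\partial S$ and to the sides of the polygon (whose corners they avoid). Choose a piecewise smooth parameterization $\phi:[0,1]\to\partial T$,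 with $\phi(0)=\phi(1)$, running once around $\partial T$ in either direction. It orders $K$ linearly: $i<j$ if $\phi$ reaches $i$ before $j$. For $i\in I$, $j\in K$ let $s_{ij}$ be the number of elements of $I$ strictly between $i$ and $j$. A path $P:i\rightsquigarrow j$ is a finite sequence of consecutive directed edges leading from $i$ to $j$ (the empty path is allowed if $i=j$). For $i\in I$, $j\in K$ and $P:i\rightsquigarrow j$ let $C(P)$ be the closed curve in the plane that follows $P$ from $i$ to $j$ and then $\partial T$, in the direction of $\phi$, from $j$ to $i$ (once around if $i=j$); each time it leaves the polygon through a side, the exit point is connected to the entry point by following the sides of the polygon clockwise. Let $r_P\in\mathbb Z$ be the rotation number of $C(P)$, that is, the degree of its unit tangent vector after smoothing the corners: $\frac1{2\pi}$ times the total turning of the tangent along the smooth pieces plus the exterior angles at the corners. For edge weights $\{y_e\}_{e\in E}$ put $\operatorname{wt}_y(P)=\prod_{e\in P}y_e$ (a product over the edges of $P$ with multiplicity). In the ring $\mathbb R[[x_e:e\in E]]$ of formal power series define the $I\times K$ matrices $$A(N,\{y_e\})_{ij}=\sum_{P:i\rightsquigarrow j}\operatorname{wt}_y(P),\qquad B(N,\{y_e\})_{ij}=\sum_{P:i\rightsquigarrow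 j}(-1)^{s_{ij}+r_P+1}\operatorname{wt}_y(P).$$ $A$ is the weighted path matrix restricted to the rows $I$ and columns $K$, and $B$ is the boundary measurement matrix. **Theorem.** If $N=(V,E)$ is a perfectly oriented network embedded on a compact connected orientable surface with nonempty boundary then, for every choice of the planar drawing, of the cuts and of $\phi$ as above, there is a collection $\{\epsilon_e\}_{e\in E}\in\{\pm1\}^E$ such that $$B(N,\{x_e\}_{e\in E})=A(N,\{\epsilon_e x_e\}_{e\in E}).$$ -/

import Mathlib

open Set
open scoped ContDiff ComplexConjugate MvPowerSeries.WithPiTopology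

noncomputable section

/-! ### Smooth arcs in the plane and rotation numbers of closed curves -/

/-- A smooth arc in the plane `ℂ = ℝ²`, parameterized by `[0,1]` with nowhere zero derivative.
(The parameterization is recorded as a smooth function on `ℝ`; only `[0,1]` is used.) -/
structure PlanarArc where
  toFun : ℝ → ℂ
  smooth : ContDiff ℝ ∞ toFun
  regular : ∀ t ∈ Icc (0 : ℝ) 1, deriv toFun t ≠ 0

namespace PlanarArc

/-- Velocity at time `t`. -/
def vel (γ : PlanarArc) (t : ℝ) : ℂ := deriv γ.toFun t

def start (γ : PlanarArc) : ℂ := γ.toFun 0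

def finish (γ : PlanarArc) : ℂ := γ.toFun 1

/-- The same arc traversed backwards. -/
def reverse (γ : PlanarArc) : PlanarArc where
  toFun t := γ.toFun (1 - t)
  smooth := γ.smooth.comp (contDiff_const.sub contDiff_id)
  regular t ht := by
    rw [deriv_comp_const_sub]
    exact neg_ne_zero.mpr (γ.regular _ ⟨by linarith [ht.2], by linarith [ht.1]⟩)

/-- The direction of the tangent vector has a continuous angle along the arc. -/
theorem exists_angle (γ : PlanarArc) : ∃ θ : ℝ → ℝ, ContinuousOn θ (Icc 0 1) ∧
    ∀ t ∈ Icc (0 : ℝ) 1, γ.vel t = (‖γ.vel t‖ : ℂ) * Complex.exp (θ t * Complex.I) := by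
  have hc : Continuous γ.vel := γ.smooth.continuous_deriv (by simp)
  have hne : ∀ t : unitInterval, γ.vel t ≠ 0 := fun t => γ.regular t t.2
  let f : C(unitInterval, Circle) :=
    ⟨fun t => ⟨γ.vel t / (‖γ.vel t‖ : ℂ), by
        rw [Submonoid.unitSphere, Submonoid.mem_mk]
        simp [hne t]⟩, by
      refine Continuous.subtype_mk ?_ _
      refine Continuous.div (hc.comp continuous_subtype_val) ?_ ?_
      · exact Complex.continuous_ofReal.comp (hc.comp continuous_subtype_val).norm
      · intro t
        simpa using hne t⟩
  have h0 : f 0 = Circle.exp (Complex.arg (f 0)) := (Circle.exp_arg (f 0)).symm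
  let Γ := Circle.isCoveringMap_exp.liftPath f (Complex.arg (f 0)) h0
  have hΓ := Circle.isCoveringMap_exp.liftPath_lifts f (Complex.arg (f 0)) h0
  refine ⟨Set.IccExtend (zero_le_one) Γ, (Γ.continuous.Icc_extend').continuousOn, ?_⟩
  intro t ht
  rw [Set.IccExtend_of_mem _ _ ht]
  have h1 := congrArg (fun z : Circle => (z : ℂ)) (congrFun hΓ ⟨t, ht⟩)
  simp only [Function.comp_apply, Circle.coe_exp] at h1
  change Complex.exp ((Γ ⟨t, ht⟩ : ℝ) * Complex.I) = γ.vel t / (‖γ.vel t‖ : ℂ) at h1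
  rw [h1]
  have : (‖γ.vel t‖ : ℂ) ≠ 0 := by simpa using hne ⟨t, ht⟩
  field_simp

/-- The total angle by which the tangent vector turns along the arc. -/
def turning (γ : PlanarArc) : ℝ := γ.exists_angle.choose 1 - γ.exists_angle.choose 0

/-- The exterior angle in `(-π, π]` at a corner where `γ` is followed by `δ`: the angle by which
the tangent vector turns when the corner is smoothed. -/
def extAngle (γ δ : PlanarArc) : ℝ := Complex.arg (δ.vel 0 / γ.vel 1)

/-- Total turning of the tangent vector along the piecewise smooth closed curve formed by a
cyclic sequence of arcs. -/
def totalTurning (l : List PlanarArc) : ℝ :=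
  (l.map turning).sum + (List.zipWith extAngle l (l.rotate 1)).sum

theorem exp_turning (γ : PlanarArc) :
    Complex.exp (γ.turning * Complex.I) =
      (γ.vel 1 / (‖γ.vel 1‖ : ℂ)) / (γ.vel 0 / (‖γ.vel 0‖ : ℂ)) := by
  obtain ⟨-, h⟩ := γ.exists_angle.choose_spec
  have h0 := h 0 (by simp)
  have h1 := h 1 (by simp)
  have n0 : (‖γ.vel 0‖ : ℂ) ≠ 0 := by simpa [vel] using γ.regular 0 (by simp)
  have n1 : (‖γ.vel 1‖ : ℂ) ≠ 0 := by simpa [vel] using γ.regular 1 (by simp)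
  rw [turning]
  push_cast
  rw [sub_mul, Complex.exp_sub]
  congr 1
  · rw [eq_div_iff n1, mul_comm]; exact h1.symm
  · rw [eq_div_iff n0, mul_comm]; exact h0.symm

theorem exp_extAngle (γ δ : PlanarArc) :
    Complex.exp (extAngle γ δ * Complex.I) =
      (δ.vel 0 / (‖δ.vel 0‖ : ℂ)) / (γ.vel 1 / (‖γ.vel 1‖ : ℂ)) := by
  have d0 : δ.vel 0 ≠ 0 := δ.regular 0 (by simp)
  have g1 : γ.vel 1 ≠ 0 := γ.regular 1 (by simp)
  have n0 : (‖δ.vel 0‖ : ℂ) ≠ 0 := by simpa using d0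
  have n1 : (‖γ.vel 1‖ : ℂ) ≠ 0 := by simpa using g1
  have h := Complex.norm_mul_exp_arg_mul_I (δ.vel 0 / γ.vel 1)
  rw [norm_div] at h
  push_cast at h
  rw [extAngle]
  field_simp
  field_simp at h
  linear_combination h

theorem exp_sum_turning (l : List PlanarArc) :
    Complex.exp (((l.map turning).sum : ℝ) * Complex.I) =
      (l.map fun γ => γ.vel 1 / (‖γ.vel 1‖ : ℂ)).prod /
        (l.map fun γ => γ.vel 0 / (‖γ.vel 0‖ : ℂ)).prod := by
  induction l with
  | nil => simp
  | cons a l ih =>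
    simp only [List.map_cons, List.sum_cons, List.prod_cons]
    push_cast at ih ⊢
    rw [add_mul, Complex.exp_add, ih, exp_turning, div_mul_div_comm]

theorem exp_sum_extAngle (l m : List PlanarArc) (h : l.length = m.length) :
    Complex.exp (((List.zipWith extAngle l m).sum : ℝ) * Complex.I) =
      (m.map fun γ => γ.vel 0 / (‖γ.vel 0‖ : ℂ)).prod /
        (l.map fun γ => γ.vel 1 / (‖γ.vel 1‖ : ℂ)).prod := by
  induction l generalizing m with
  | nil =>
    obtain rfl : m = [] := by simpa using h.symm
    simp
  | cons a l ih =>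
    cases m with
    | nil => simp at h
    | cons b m =>
      simp only [List.zipWith_cons_cons, List.map_cons, List.sum_cons, List.prod_cons]
      have ih' := ih m (by simpa using h)
      push_cast at ih' ⊢
      rw [add_mul, Complex.exp_add, ih', exp_extAngle, div_mul_div_comm]

theorem exists_rotationNumber (l : List PlanarArc) :
    ∃ r : ℤ, totalTurning l = 2 * Real.pi * r := by
  have hu : ∀ t ∈ Icc (0 : ℝ) 1, (l.map fun γ => γ.vel t / (‖γ.vel t‖ : ℂ)).prod ≠ 0 := by
    intro t ht
    apply List.prod_ne_zero
    simp only [List.mem_map, not_exists, not_and]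
    intro γ _ h0
    have hne : γ.vel t ≠ 0 := γ.regular t ht
    simp [hne] at h0
  have h : Complex.exp ((totalTurning l : ℝ) * Complex.I) = 1 := by
    rw [totalTurning, Complex.ofReal_add, add_mul, Complex.exp_add, exp_sum_turning,
      exp_sum_extAngle l (l.rotate 1) (by simp),
      ((l.rotate_perm 1).map _).prod_eq]
    have h0 := hu 0 (by simp)
    have h1 := hu 1 (by simp)
    field_simp
  obtain ⟨n, hn⟩ := Complex.exp_eq_one_iff.mp h
  refine ⟨n, ?_⟩
  have h2 : (totalTurning l : ℂ) = n * (2 * Real.pi) := by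
    apply mul_right_cancel₀ Complex.I_ne_zero
    rw [hn]; ring
  have h3 : totalTurning l = n * (2 * Real.pi) := by exact_mod_cast h2
  rw [h3]; ring

/-- The rotation number of the piecewise smooth closed curve formed by a cyclic sequence of arcs:
the degree of its unit tangent vector, after smoothing the corners. -/
def rotationNumber (l : List PlanarArc) : ℤ := (exists_rotationNumber l).choose

end PlanarArc

/-! ### Surfaces, drawn in the plane -/

/-- The vertex with number `k` (mod `4g`) of the regular `4g`-gon inscribed in the unit circle,
in counterclockwise order. -/
def polygonCorner (g : ℕ) (k : ℤ) : ℂ := Complex.exp (2 * Real.pi * Complex.I * k / (4 * g))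

/-- The point with parameter `a ∈ [0,1]` on the side from corner `k` to corner `k + 1`. -/
def sidePoint (g : ℕ) (k : ℤ) (a : ℝ) : ℂ :=
  polygonCorner g k + a * (polygonCorner g (k + 1) - polygonCorner g k)

/-- The open disk (genus `0`) or open `4g`-gon (genus `g > 0`) inside which the surface is drawn. -/
def openFace (g : ℕ) : Set ℂ :=
  if g = 0 then Metric.ball 0 1 else interior (convexHull ℝ (range (polygonCorner g)))

/-- A compact connected orientable surface with nonempty boundary, given in the plane. In genus `0`
it is the closed unit disk with some open round disks removed (the unit circle being
the external boundary component). In genus `g > 0` it is the punctured fundamental polygon: a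
`4g`-gon with some open round disks removed, with side `s` glued to side `pair s` reversing
their counterclockwise directions. All corners of the polygon are the same point of the
surface, so that the sides are `2g` loops generating the homology of the closed surface. -/
structure PuncturedPolygon where
  genus : ℕ
  pair : Fin (4 * genus) → Fin (4 * genus)
  pair_pair : ∀ s, pair (pair s) = s
  pair_ne : ∀ s, pair s ≠ s
  one_corner : ∀ c c' : Fin (4 * genus), Relation.EqvGen
    (fun c c' : Fin (4 * genus) => (c' : ℕ) = ((pair c : ℕ) + 1) % (4 * genus)) c c'
  holes : ℕ
  center : Fin holes → ℂ
  radius : Fin holes → ℝ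
  radius_pos : ∀ h, 0 < radius h
  hole_subset : ∀ h, Metric.closedBall (center h) (radius h) ⊆ openFace genus
  hole_disjoint : ∀ h h', h ≠ h' →
    Disjoint (Metric.closedBall (center h) (radius h)) (Metric.closedBall (center h') (radius h'))
  has_boundary : genus = 0 ∨ 0 < holes

namespace PuncturedPolygon

variable (D : PuncturedPolygon)

/-- The open fundamental domain: all points of the surface that are neither on its boundary
nor on a side of the polygon. -/
def openDomain : Set ℂ :=
  openFace D.genus \ ⋃ h, Metric.closedBall (D.center h) (D.radius h)

/-- The gluing of the sides. -/
def Glue (z w : ℂ) : Prop :=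
  ∃ s : Fin (4 * D.genus), ∃ a ∈ Icc (0 : ℝ) 1,
    z = sidePoint D.genus (s : ℕ) a ∧ w = sidePoint D.genus (D.pair s : ℕ) (1 - a)

/-- Points modulo the gluing; the points of the surface are the classes of the points in the
punctured polygon. -/
def Point : Type := Quot D.Glue

def proj (z : ℂ) : D.Point := Quot.mk _ z

/-- The boundary components: one for each hole and, in genus `0`, the unit circle (`none`). -/
def Component : Type := {o : Option (Fin D.holes) // o = none → D.genus = 0}

/-- The number `b` of boundary components. -/
def numComponents : ℕ := D.holes + if D.genus = 0 then 1 else 0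

variable {D}

def Component.center (c : D.Component) : ℂ := c.1.elim 0 D.center

def Component.radius (c : D.Component) : ℝ := c.1.elim 1 D.radius

/-- The boundary circle, a smooth closed curve. -/
def Component.circle (c : D.Component) : Set ℂ := Metric.sphere c.center c.radius

/-- `1` for the external circle and `-1` for a hole: the surface lies to the left of the circle
when the circle is traversed counterclockwise, respectively clockwise. -/
def Component.sign (c : D.Component) : ℝ := c.1.elim 1 (fun _ => -1)

/-- The vector `u` at the point `z` of the boundary circle `c` points strictly into the surface. -/
def Component.PointsInward (c : D.Component) (z u : ℂ) : Prop :=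
  c.sign * (conj (z - c.center) * u).re < 0

theorem Component.radius_pos (c : D.Component) : 0 < c.radius := by
  rcases c with ⟨_ | h, hc⟩
  · exact one_pos
  · exact D.radius_pos h

variable (D) in
def boundary : Set ℂ := ⋃ c : D.Component, c.circle

/-- The arc of the boundary circle `c` of angular length `ℓ` starting at angle `a`. For `σ = 1` the
surface lies to the left of the arc, for `σ = -1` to its right. -/
def circleArc (σ : ℤˣ) (c : D.Component) (a ℓ : ℝ) (hℓ : 0 < ℓ) : PlanarArc where
  toFun t := c.center + c.radius *
    Complex.exp (((a + ((σ : ℤ) : ℝ) * c.sign * ℓ * t : ℝ) : ℂ) * Complex.I)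
  smooth := by
    refine contDiff_const.add (contDiff_const.mul (ContDiff.cexp (ContDiff.mul ?_ contDiff_const)))
    exact Complex.ofRealCLM.contDiff.comp (contDiff_const.add (contDiff_const.mul contDiff_id))
  regular t _ := by
    have h1 : HasDerivAt (fun t : ℝ => a + ((σ : ℤ) : ℝ) * c.sign * ℓ * t)
        (((σ : ℤ) : ℝ) * c.sign * ℓ) t := by
      simpa using ((hasDerivAt_id t).const_mul (((σ : ℤ) : ℝ) * c.sign * ℓ)).const_add a
    have h2 := (((h1.ofReal_comp).mul_const Complex.I).cexp.const_mul
      (c.radius : ℂ)).const_add c.center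
    rw [h2.deriv]
    have hs : c.sign ≠ 0 := by
      rcases c with ⟨_ | h, hc⟩ <;> simp [Component.sign]
    have hσ : (((σ : ℤ) : ℝ)) ≠ 0 := by exact_mod_cast σ.ne_zero
    have hr := c.radius_pos.ne'
    refine mul_ne_zero (by exact_mod_cast hr) (mul_ne_zero (Complex.exp_ne_zero _)
      (mul_ne_zero ?_ Complex.I_ne_zero))
    exact_mod_cast mul_ne_zero (mul_ne_zero hσ hs) hℓ.ne'

theorem side_ne (g : ℕ) (hg : 0 < g) (k : ℤ) :
    polygonCorner g (k + 1) - polygonCorner g k ≠ 0 := by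
  intro h
  have h1 : polygonCorner g (k + 1) = polygonCorner g k := sub_eq_zero.mp h
  obtain ⟨n, hn⟩ := Complex.exp_eq_exp_iff_exists_int.mp h1
  have hg' : (g : ℂ) ≠ 0 := by exact_mod_cast hg.ne'
  have hp : (2 * Real.pi * Complex.I : ℂ) ≠ 0 := Complex.two_pi_I_ne_zero
  have h2 : (2 * Real.pi * Complex.I : ℂ) * 1 = (2 * Real.pi * Complex.I : ℂ) * (4 * g * n) := by
    push_cast at hn
    field_simp at hn
    linear_combination (2 * Real.pi * Complex.I : ℂ) * hn
  have h3 := mul_left_cancel₀ hp h2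
  have h4 : (1 : ℤ) = 4 * g * n := by exact_mod_cast h3
  have : (4 : ℤ) ∣ 1 := ⟨g * n, by rw [h4]; ring⟩
  norm_num at this

/-- The segment of side `k` of the `4g`-gon from parameter `a` to parameter `b`. -/
def sideArc (g : ℕ) (hg : 0 < g) (k : ℤ) (a b : ℝ) (hab : a ≠ b) : PlanarArc where
  toFun t := sidePoint g k (a + (b - a) * t)
  smooth := by
    refine contDiff_const.add (ContDiff.mul ?_ contDiff_const)
    exact Complex.ofRealCLM.contDiff.comp (contDiff_const.add (contDiff_const.mul contDiff_id))
  regular t _ := by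
    have h1 : HasDerivAt (fun t : ℝ => a + (b - a) * t) (b - a) t := by
      simpa using ((hasDerivAt_id t).const_mul (b - a)).const_add a
    have h2 := ((h1.ofReal_comp).mul_const
      (polygonCorner g (k + 1) - polygonCorner g k)).const_add (polygonCorner g k)
    have h3 : deriv (fun t : ℝ => sidePoint g k (a + (b - a) * t)) t = _ := h2.deriv
    rw [h3]
    refine mul_ne_zero ?_ (side_ne g hg k)
    exact_mod_cast sub_ne_zero.mpr hab.symm

/-! ### Curves on the surface -/

variable (D) in
/-- A crossing of a side of the polygon: leave through side `side` at parameter `param` and enter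
through the side glued to it. -/
structure Crossing where
  side : Fin (4 * D.genus)
  param : ℝ
  param_pos : 0 < param
  param_lt : param < 1

namespace Crossing

theorem genus_pos (x : D.Crossing) : 0 < D.genus := by
  have := x.side.2
  omega

/-- The same crossing in the opposite direction. -/
def reverse (x : D.Crossing) : D.Crossing where
  side := D.pair x.side
  param := 1 - x.param
  param_pos := by linarith [x.param_lt]
  param_lt := by linarith [x.param_pos]

def exitPoint (x : D.Crossing) : ℂ := sidePoint D.genus (x.side : ℕ) x.param

def entryPoint (x : D.Crossing) : ℂ := x.reverse.exitPoint

/-- Direction of the exit side, which has the polygon to its left. -/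
def sideDir (x : D.Crossing) : ℂ :=
  polygonCorner D.genus ((x.side : ℕ) + 1) - polygonCorner D.genus (x.side : ℕ)

/-- The number of corners passed when following the sides clockwise from exit to entry. -/
def steps (x : D.Crossing) : ℕ := (x.side + 4 * D.genus - D.pair x.side) % (4 * D.genus)

/-- The polygonal curve following the sides of the polygon clockwise from the exit point to the
entry point. -/
def detour (x : D.Crossing) : List PlanarArc :=
  sideArc D.genus x.genus_pos (x.side : ℕ) x.param 0 x.param_pos.ne' ::
    (List.range (x.steps - 1)).map (fun k =>
      sideArc D.genus x.genus_pos ((x.side : ℕ) - (k + 1 : ℕ)) 1 0 one_ne_zero) ++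
    [sideArc D.genus x.genus_pos (D.pair x.side : ℕ) 1 (1 - x.param)
      (by linarith [x.param_pos] : 1 - x.param < 1).ne']

end Crossing

variable (D) in
/-- A curve on the surface, seen in the plane: arcs in the punctured polygon, with a crossing of a
side between two consecutive arcs. -/
structure Curve where
  num : ℕ
  arc : Fin (num + 1) → PlanarArc
  cross : Fin num → D.Crossing

namespace Curve

def start (c : D.Curve) : ℂ := (c.arc 0).start

def finish (c : D.Curve) : ℂ := (c.arc (Fin.last _)).finish

def startDir (c : D.Curve) : ℂ := (c.arc 0).vel 0

def finishDir (c : D.Curve) : ℂ := (c.arc (Fin.last _)).vel 1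

def reverse (c : D.Curve) : D.Curve where
  num := c.num
  arc k := (c.arc k.rev).reverse
  cross k := (c.cross k.rev).reverse

/-- The curve in the plane that runs through the arcs and connects each exit point to the
next entry point clockwise along the sides of the polygon. -/
def drawn (c : D.Curve) : List PlanarArc :=
  c.arc 0 :: (List.finRange c.num).flatMap (fun k => (c.cross k).detour ++ [c.arc k.succ])

/-- The points of the surface on the curve. -/
def trace (c : D.Curve) : Set D.Point :=
  {x | ∃ k, ∃ t ∈ Icc (0 : ℝ) 1, x = D.proj ((c.arc k).toFun t)}

/-- `c` is a smooth simple curve (simple closed if its ends agree) whose points other than its ends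
are interior points of the surface, and which meets the sides of the polygon transversally
and not in the corners. (No relation is imposed between the lengths and angles of the velocity
on the two sides of a crossing: they depend on the choice of the gluing maps.) -/
structure IsEmbedded (c : D.Curve) : Prop where
  mem_domain : ∀ k, ∀ t ∈ Ioo (0 : ℝ) 1, (c.arc k).toFun t ∈ D.openDomain
  exit_eq : ∀ k, (c.arc k.castSucc).finish = (c.cross k).exitPoint
  entry_eq : ∀ k, (c.arc k.succ).start = (c.cross k).entryPoint
  exit_transversal : ∀ k, (conj (c.cross k).sideDir * (c.arc k.castSucc).vel 1).im < 0
  entry_transversal : ∀ k, 0 < (conj (c.cross k).reverse.sideDir * (c.arc k.succ).vel 0).im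
  simple : ∀ k k', ∀ t ∈ Ico (0 : ℝ) 1, ∀ t' ∈ Ico (0 : ℝ) 1,
    D.proj ((c.arc k).toFun t) = D.proj ((c.arc k').toFun t') → k = k' ∧ t = t'
  simple_finish : ∀ k, ∀ t ∈ Ico (0 : ℝ) 1,
    D.proj ((c.arc k).toFun t) = D.proj c.finish → k = 0 ∧ t = 0

end Curve

end PuncturedPolygon

/-! ### Directed networks on the surface -/

/-- A directed network with vertex set `V` and edge set `E` embedded on the surface `D`. -/
structure Network (D : PuncturedPolygon) (V E : Type*) where
  src : E → V
  tgt : E → V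
  pos : V → ℂ
  pos_injective : Function.Injective pos
  pos_mem : ∀ v, pos v ∈ D.openDomain ∨ pos v ∈ D.boundary
  curve : E → D.Curve
  curve_embedded : ∀ e, (curve e).IsEmbedded
  start_eq : ∀ e, (curve e).start = pos (src e)
  finish_eq : ∀ e, (curve e).finish = pos (tgt e)
  vertex_on_edge : ∀ v e, D.proj (pos v) ∈ (curve e).trace → v = src e ∨ v = tgt e
  edges_disjoint : ∀ e f, e ≠ f → ∀ x ∈ (curve e).trace, x ∈ (curve f).trace →
    ∃ v, x = D.proj (pos v)
  -- edges are not tangent to the boundary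
  start_inward : ∀ e (c : D.Component), pos (src e) ∈ c.circle →
    c.PointsInward (pos (src e)) (curve e).startDir
  finish_outward : ∀ e (c : D.Component), pos (tgt e) ∈ c.circle →
    c.PointsInward (pos (tgt e)) (-(curve e).finishDir)
  -- paths have corners but no cusps at the vertices, so that they can be smoothed
  no_cusp : ∀ e f, tgt e = src f →
    ¬ ∃ r : ℝ, r < 0 ∧ (curve f).startDir = r * (curve e).finishDir

namespace Network

variable {D : PuncturedPolygon} {V E : Type*} (N : Network D V E)

/-- The set `K` of boundary vertices. -/
def K : Set V := {v | N.pos v ∈ D.boundary}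

/-- The set `I` of boundary vertices that are sources. -/
def I : Set V := {v | v ∈ N.K ∧ ∀ e, N.tgt e ≠ v}

def inDegree (v : V) : ℕ := {e | N.tgt e = v}.ncard

def outDegree (v : V) : ℕ := {e | N.src e = v}.ncard

/-- Boundary vertices are univalent (hence a source or a sink); interior vertices are trivalent and
neither a source nor a sink. -/
def PerfectlyOriented : Prop :=
  (∀ v ∈ N.K, N.inDegree v + N.outDegree v = 1) ∧
  (∀ v ∉ N.K, N.inDegree v + N.outDegree v = 3 ∧ N.inDegree v ≠ 0 ∧ N.outDegree v ≠ 0)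

/-- The list of edges is a path from `i` to `j`. -/
def IsPath : V → List E → V → Prop
  | i, [], j => i = j
  | i, e :: P, j => N.src e = i ∧ IsPath (N.tgt e) P j

/-- The paths from `i` to `j`. -/
def Path (i j : V) : Type _ := {P : List E // N.IsPath i P j}

variable {N} in
/-- The weight of a path, for edge weights `y`. -/
def Path.wt {i j : V} (P : N.Path i j) (y : E → MvPowerSeries E ℝ) : MvPowerSeries E ℝ :=
  (P.1.map y).prod

/-- The weighted path matrix `M(N, y)`. The sum over all paths is taken in the ring of formal power
series with the topology of coefficientwise convergence. -/
def M (y : E → MvPowerSeries E ℝ) : Matrix V V (MvPowerSeries E ℝ) :=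
  Matrix.of fun i j => ∑' P : N.Path i j, P.wt y

/-- The restriction `A(N, y)` of the weighted path matrix to the rows `I` and columns `K`. -/
def A (y : E → MvPowerSeries E ℝ) : Matrix N.I N.K (MvPowerSeries E ℝ) :=
  (N.M y).submatrix Subtype.val Subtype.val

end Network

/-! ### Cuts and the boundary of the cut surface -/

/-- A piece of the boundary of the cut surface: an arc of a boundary circle of the original
surface, or one of the two sides of a cut (`rev` says in which direction the cut is followed). -/
inductive BoundaryPiece (D : PuncturedPolygon)
  | arc (c : D.Component) (a ℓ : ℝ) (hℓ : 0 < ℓ) : BoundaryPiece D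
  | cut (k : Fin (D.numComponents - 1)) (rev : Bool) : BoundaryPiece D

namespace BoundaryPiece

variable {D : PuncturedPolygon}

def IsCut : BoundaryPiece D → Prop
  | arc _ _ _ _ => False
  | cut _ _ => True

/-- The cut `k`, followed in the given direction. -/
def cutCurve (cuts : Fin (D.numComponents - 1) → D.Curve) (k : Fin (D.numComponents - 1))
    (rev : Bool) : D.Curve :=
  if rev then (cuts k).reverse else cuts k

/-- The piece as a curve in the plane. -/
def drawn (cuts : Fin (D.numComponents - 1) → D.Curve) (σ : ℤˣ) :
    BoundaryPiece D → List PlanarArc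
  | arc c a ℓ hℓ => [PuncturedPolygon.circleArc σ c a ℓ hℓ]
  | cut k rev => (cutCurve cuts k rev).drawn

def start (cuts : Fin (D.numComponents - 1) → D.Curve) (σ : ℤˣ) : BoundaryPiece D → ℂ
  | arc c a ℓ hℓ => (PuncturedPolygon.circleArc σ c a ℓ hℓ).start
  | cut k rev => (cutCurve cuts k rev).start

def finish (cuts : Fin (D.numComponents - 1) → D.Curve) (σ : ℤˣ) : BoundaryPiece D → ℂ
  | arc c a ℓ hℓ => (PuncturedPolygon.circleArc σ c a ℓ hℓ).finish
  | cut k rev => (cutCurve cuts k rev).finish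

end BoundaryPiece

/-- A choice of `b - 1` cuts between pairs of boundary components, such that the cut surface `T` has
a single boundary component, and a piecewise smooth parameterization of `∂T`.

The parameterization is given by its sequence of pieces `piece 0, …, piece (len - 1)`, followed
cyclically: it passes once along each side of each cut and once along each boundary circle, always
with the surface on the same side (to the left if `orient = 1`, to the right if `orient = -1`), and
it turns at every end of a cut from the cut into the boundary circle and from the boundary
circle into the cut. Arcs of boundary circles may be subdivided, and they are subdivided at least at
the boundary vertices of the network: `place v` is the number of the piece that starts at `v`. -/
structure CutSurface {D : PuncturedPolygon} {V E : Type*} (N : Network D V E) where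
  cuts : Fin (D.numComponents - 1) → D.Curve
  cuts_embedded : ∀ k, (cuts k).IsEmbedded
  cuts_ends : ∀ k, ∃ c c' : D.Component, c ≠ c' ∧
    (cuts k).start ∈ c.circle ∧ (cuts k).finish ∈ c'.circle ∧
    c.PointsInward (cuts k).start (cuts k).startDir ∧
    c'.PointsInward (cuts k).finish (-(cuts k).finishDir)
  cuts_disjoint : ∀ k k', k ≠ k' → Disjoint (cuts k).trace (cuts k').trace
  cuts_vertices : ∀ k v, D.proj (N.pos v) ∉ (cuts k).trace
  cuts_transversal : ∀ k e m n, ∀ t ∈ Icc (0 : ℝ) 1, ∀ u ∈ Icc (0 : ℝ) 1,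
    ((cuts k).arc m).toFun t = ((N.curve e).arc n).toFun u →
      (conj (((cuts k).arc m).vel t) * ((N.curve e).arc n).vel u).im ≠ 0
  orient : ℤˣ
  len : ℕ
  len_pos : 0 < len
  piece : Fin len → BoundaryPiece D
  piece_joins : ∀ m m' : Fin len, (m' : ℕ) = (m + 1) % len →
    (piece m).finish cuts orient = (piece m').start cuts orient
  piece_alternates : ∀ m m' : Fin len, (m' : ℕ) = (m + 1) % len →
    ¬ ((piece m).IsCut ∧ (piece m').IsCut)
  cut_once : ∀ k rev, ∃! m, piece m = BoundaryPiece.cut k rev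
  circle_once : ∀ (c : D.Component), ∀ z ∈ c.circle, ∃! p : Fin len × ℝ,
    p.2 ∈ Ico (0 : ℝ) 1 ∧ ∃ a ℓ hℓ, piece p.1 = BoundaryPiece.arc c a ℓ hℓ ∧
      (PuncturedPolygon.circleArc orient c a ℓ hℓ).toFun p.2 = z
  place : N.K → Fin len
  place_arc : ∀ v, ¬ (piece (place v)).IsCut
  place_start : ∀ v, (piece (place v)).start cuts orient = N.pos v

namespace CutSurface

variable {D : PuncturedPolygon} {V E : Type*} {N : Network D V E} (T : CutSurface N)

/-- The part of `∂T` followed, in the chosen direction, from the boundary vertex `j` to the boundary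
vertex `i`; once around if `i = j`. -/
def boundaryFromTo (j i : N.K) : List PlanarArc :=
  let d := ((T.place i : ℕ) + T.len - T.place j) % T.len
  (List.range (if d = 0 then T.len else d)).flatMap fun m =>
    (T.piece ⟨(T.place j + m) % T.len, Nat.mod_lt _ T.len_pos⟩).drawn T.cuts T.orient

/-- The closed curve `C(P)` in the plane: the path `P` from `i` to `j`, then `∂T` from `j` to `i`. -/
def closedCurve (i j : N.K) (P : N.Path i j) : List PlanarArc :=
  P.1.flatMap (fun e => (N.curve e).drawn) ++ T.boundaryFromTo j i

/-- The number `s_{ij}` of boundary sources strictly between `i` and `j`, in the linear order of the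
boundary vertices along the parameterization of `∂T`. -/
def between (i j : N.K) : ℕ :=
  {k : N.K | k.1 ∈ N.I ∧ ((T.place i < T.place k ∧ T.place k < T.place j) ∨
    (T.place j < T.place k ∧ T.place k < T.place i))}.ncard

/-- The boundary measurement matrix `B(N, y)`. -/
def B (y : E → MvPowerSeries E ℝ) : Matrix N.I N.K (MvPowerSeries E ℝ) :=
  Matrix.of fun i j => ∑' P : N.Path i j,
    ((-1 : ℝ) ^ ((T.between ⟨i, i.2.1⟩ j : ℤ) +
      PlanarArc.rotationNumber (T.closedCurve ⟨i, i.2.1⟩ j P) + 1)) • P.wt y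

end CutSurface

/-- The series defining `M`, `A` and `B` converge for all edge weights `a_e x_e`. -/
theorem Network.summable_wt {D : PuncturedPolygon} {V E : Type*} [Finite E] (N : Network D V E)
    (i j : V) (a : E → ℝ) (c : N.Path i j → ℝ) :
    Summable fun P : N.Path i j =>
      c P • P.wt (fun e => MvPowerSeries.C (a e) * MvPowerSeries.X e) := by
  classical
  have hwt : ∀ l : List E,
      (l.map fun e => (MvPowerSeries.C (a e) * MvPowerSeries.X e : MvPowerSeries E ℝ)).prod =
        MvPowerSeries.monomial (l.map fun e => Finsupp.single e 1).sum (l.map a).prod := by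
    intro l
    induction l with
    | nil => simp
    | cons e l ih =>
      simp only [List.map_cons, List.prod_cons, List.sum_cons, ih]
      rw [MvPowerSeries.X, ← MvPowerSeries.monomial_zero_eq_C_apply,
        MvPowerSeries.monomial_mul_monomial, MvPowerSeries.monomial_mul_monomial]
      simp
  rw [MvPowerSeries.WithPiTopology.summable_iff_summable_coeff]
  intro d
  apply summable_of_hasFiniteSupport
  have hlen : ∀ l : List E,
      ((l.map fun e => (Finsupp.single e 1 : E →₀ ℕ)).sum).degree = l.length := by
    intro l
    induction l with
    | nil => simp
    | cons e l ih => simp [ih, add_comm]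
  refine Set.Finite.subset (((List.finite_length_eq E d.degree).preimage
    Subtype.val_injective.injOn : Set.Finite {P : N.Path i j | P.1.length = d.degree})) ?_
  intro P hP
  by_contra hne
  apply hP
  have : (P.1.map fun e => (Finsupp.single e 1 : E →₀ ℕ)).sum ≠ d := by
    rintro rfl
    exact hne (hlen P.1).symm
  simp only [Network.Path.wt, hwt, map_smul, MvPowerSeries.coeff_monomial, smul_eq_mul]
  rw [if_neg (Ne.symm this), mul_zero]

end

/-! The sign of a path splits into edge signs once its rotation number splits into integers attached
to edges. Each edge `e` gets real lifts `αs e`, `αf e` of the directions at its two ends. At an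
interior vertex the exterior angle from `e` to `f` should be exactly `αs f - αf e`, not merely
modulo `2π`. This is possible because a trivalent vertex that is neither source nor sink has a
single incoming or a single outgoing edge: that edge fixes the lifts of the others
(`exists_edge_angles`). At a boundary vertex the lift is matched to a running angle along `∂T`,
measured from its base point. The turning of each drawn edge is then `αf e - αs e + 2π n e` with an
integer `n e`.

Around `C(P)`, for nonempty `P`, all lifts telescope. What remains is `r_P = ∑ n e`, plus the
rotation number `R` of `∂T` unless `j` precedes `i`, that is, exactly when the return along `∂T`
passes the base point (`rotationNumber_cons`). The empty path has `r_P = R`.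

The number `R` is odd (`exists_odd_turningTo_len`). The `b` boundary circles contribute `±2π` each.
The two sides of a cut are a curve and its reverse: their smooth turnings cancel, the four corners
at the ends give `±2π`, and each crossing of a polygon side gives `-4π`. Modulo 2 this is `b + (b -
1)`.

If `S v` counts the boundary sources before `v`, then `s_ij` is `S j - S i - 1` for `i < j` and `S i
- S j` for `j < i`. The oddness of `R` compensates for the extra `-1`, so in both cases `s_ij + r_P
+ 1` is congruent to `∑ n e + (S i + 1) + S j` modulo 2. Boundary vertices are univalent, hence met
only at the ends of a path, so `S i + 1` can be charged to edges leaving `i` and `S j` to edges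
entering `j`. -/

/-! ### Turning of open chains of arcs -/

namespace PlanarArc

/-- The unit vector in the direction of `z`. -/
noncomputable def unitVec (z : ℂ) : ℂ := z / (‖z‖ : ℂ)

theorem unitVec_ne_zero {z : ℂ} (hz : z ≠ 0) : unitVec z ≠ 0 := by
  simp [unitVec, hz]

theorem exp_arg_div {z w : ℂ} (hz : z ≠ 0) (hw : w ≠ 0) :
    Complex.exp ((z / w).arg * Complex.I) = unitVec z / unitVec w := by
  have n0 : (‖z‖ : ℂ) ≠ 0 := by simpa using hz
  have n1 : (‖w‖ : ℂ) ≠ 0 := by simpa using hw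
  have h := Complex.norm_mul_exp_arg_mul_I (z / w)
  rw [norm_div] at h
  push_cast at h
  rw [unitVec, unitVec]
  field_simp
  field_simp at h
  linear_combination h

theorem exp_arg_eq_unitVec {z : ℂ} (hz : z ≠ 0) :
    Complex.exp (z.arg * Complex.I) = unitVec z := by
  have := exp_arg_div hz one_ne_zero
  simpa [unitVec] using this

theorem vel_zero_ne (γ : PlanarArc) : γ.vel 0 ≠ 0 := γ.regular 0 (by simp)

theorem vel_one_ne (γ : PlanarArc) : γ.vel 1 ≠ 0 := γ.regular 1 (by simp)

/-- The turning may be computed from any continuous angle of the tangent vector. -/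
theorem turning_eq (γ : PlanarArc) (θ r : ℝ → ℝ) (hθ : ContinuousOn θ (Icc 0 1))
    (hr : ∀ t ∈ Icc (0 : ℝ) 1, 0 < r t)
    (h : ∀ t ∈ Icc (0 : ℝ) 1, γ.vel t = (r t : ℂ) * Complex.exp (θ t * Complex.I)) :
    γ.turning = θ 1 - θ 0 := by
  obtain ⟨hc, hv⟩ := γ.exists_angle.choose_spec
  set φ := γ.exists_angle.choose with hφ
  have hint : ∀ t ∈ Icc (0 : ℝ) 1, ∃ n : ℤ, φ t - θ t = n * (2 * Real.pi) := by
    intro t ht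
    have h1 := h t ht
    have h2 := hv t ht
    have hn : ‖γ.vel t‖ = r t := by
      rw [h1, norm_mul, Complex.norm_exp_ofReal_mul_I, Complex.norm_real,
        Real.norm_of_nonneg (hr t ht).le, mul_one]
    rw [hn, h1] at h2
    have hrt : (r t : ℂ) ≠ 0 := by exact_mod_cast (hr t ht).ne'
    obtain ⟨n, hn⟩ := Complex.exp_eq_exp_iff_exists_int.mp (mul_left_cancel₀ hrt h2).symm
    refine ⟨n, ?_⟩
    have : (φ t : ℂ) - θ t = n * (2 * Real.pi) := by
      apply mul_right_cancel₀ Complex.I_ne_zero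
      rw [sub_mul, hn]; ring
    exact_mod_cast this
  -- The difference of two angle functions, divided by `2π`, is continuous and integer-valued on an
  -- interval, hence constant.
  have hconst : φ 1 - θ 1 = φ 0 - θ 0 := by
    have hd : IsPreconnected ((fun t => (φ t - θ t) / (2 * Real.pi)) '' Icc (0 : ℝ) 1) :=
      isPreconnected_Icc.image _ ((hc.sub hθ).div_const _)
    have hZ : (fun t => (φ t - θ t) / (2 * Real.pi)) '' Icc (0 : ℝ) 1 ⊆
        range ((↑) : ℤ → ℝ) := by
      rintro _ ⟨t, ht, rfl⟩
      obtain ⟨n, hn⟩ := hint t ht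
      refine ⟨n, ?_⟩
      simp only [hn]
      field_simp
    have hs : ((fun t => (φ t - θ t) / (2 * Real.pi)) '' Icc (0 : ℝ) 1).Subsingleton :=
      ((countable_range ((↑) : ℤ → ℝ)).isTotallyDisconnected) _ hZ hd
    have := hs (mem_image_of_mem _ (by simp : (1 : ℝ) ∈ Icc (0 : ℝ) 1))
      (mem_image_of_mem _ (by simp : (0 : ℝ) ∈ Icc (0 : ℝ) 1))
    exact (div_left_inj' (by positivity)).mp this
  rw [turning, ← hφ]
  linarith

theorem reverse_vel (γ : PlanarArc) (t : ℝ) : γ.reverse.vel t = -γ.vel (1 - t) := by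
  simp only [vel, reverse]
  rw [deriv_comp_const_sub]

/-- Running backwards reverses the parameter of the angle and adds the constant `π` to it. -/
theorem reverse_turning (γ : PlanarArc) : γ.reverse.turning = -γ.turning := by
  obtain ⟨hc, hv⟩ := γ.exists_angle.choose_spec
  have hm : ∀ t ∈ Icc (0 : ℝ) 1, 1 - t ∈ Icc (0 : ℝ) 1 := fun t ht =>
    ⟨by linarith [ht.2], by linarith [ht.1]⟩
  rw [turning_eq γ.reverse (fun t => γ.exists_angle.choose (1 - t) + Real.pi)
    (fun t => ‖γ.vel (1 - t)‖)]
  · simp [turning]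
  · exact (hc.comp (by fun_prop) hm).add continuousOn_const
  · exact fun t ht => norm_pos_iff.mpr (γ.regular _ (hm t ht))
  · intro t ht
    rw [reverse_vel]
    push_cast
    rw [add_mul, Complex.exp_add, Complex.exp_pi_mul_I, mul_neg_one, mul_neg, ← hv _ (hm t ht)]

/-- The initial velocity of a chain of arcs. -/
noncomputable def headVel : List PlanarArc → ℂ
  | [] => 1
  | a :: _ => a.vel 0

/-- The final velocity of a chain of arcs. -/
noncomputable def lastVel : List PlanarArc → ℂ
  | [] => 1
  | [a] => a.vel 1
  | _ :: b :: l => lastVel (b :: l)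

/-- The turning of the tangent vector along a chain of arcs that is not closed up. -/
noncomputable def pathTurning : List PlanarArc → ℝ
  | [] => 0
  | [a] => a.turning
  | a :: b :: l => a.turning + extAngle a b + pathTurning (b :: l)

theorem headVel_ne_zero (l : List PlanarArc) : headVel l ≠ 0 := by
  cases l with
  | nil => exact one_ne_zero
  | cons a l => exact a.vel_zero_ne

theorem lastVel_ne_zero (l : List PlanarArc) : lastVel l ≠ 0 := by
  induction l with
  | nil => exact one_ne_zero
  | cons a l ih =>
    cases l with
    | nil => exact a.vel_one_ne
    | cons b l => exact ih

theorem headVel_append {l : List PlanarArc} (m : List PlanarArc) (hl : l ≠ []) :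
    headVel (l ++ m) = headVel l := by
  cases l with
  | nil => exact absurd rfl hl
  | cons a l => rfl

theorem lastVel_append (l : List PlanarArc) {m : List PlanarArc} (hm : m ≠ []) :
    lastVel (l ++ m) = lastVel m := by
  induction l with
  | nil => rfl
  | cons a l ih =>
    rw [List.cons_append, ← ih]
    cases h : l ++ m with
    | nil => simp_all
    | cons b k => rfl

/-- Gluing costs just the one exterior angle at the joint. Both chains must be nonempty, as the
empty chain carries the placeholder direction `1`. -/
theorem pathTurning_append {l m : List PlanarArc} (hl : l ≠ []) (hm : m ≠ []) :
    pathTurning (l ++ m) =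
      pathTurning l + (headVel m / lastVel l).arg + pathTurning m := by
  induction l with
  | nil => exact absurd rfl hl
  | cons a l ih =>
    cases l with
    | nil =>
      cases m with
      | nil => exact absurd rfl hm
      | cons b m => rfl
    | cons b l =>
      have := ih (by simp)
      simp only [List.cons_append, pathTurning, lastVel] at this ⊢
      rw [this]; ring

/-- All intermediate directions cancel, so modulo `2π` the turning depends only on the first and
last direction. This is the source of the integers attached to edges. -/
theorem exp_pathTurning {l : List PlanarArc} (hl : l ≠ []) :
    Complex.exp (pathTurning l * Complex.I) = unitVec (lastVel l) / unitVec (headVel l) := by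
  induction l with
  | nil => exact absurd rfl hl
  | cons a l ih =>
    cases l with
    | nil => exact exp_turning a
    | cons b l =>
      have := ih (by simp)
      have h1 := unitVec_ne_zero a.vel_one_ne
      have h2 := unitVec_ne_zero b.vel_zero_ne
      simp only [pathTurning, lastVel, headVel] at this ⊢
      push_cast
      rw [add_mul, add_mul, Complex.exp_add, Complex.exp_add, this, exp_turning, extAngle,
        exp_arg_div b.vel_zero_ne a.vel_one_ne]
      change unitVec (a.vel 1) / unitVec (a.vel 0) * _ * _ = _
      field_simp

theorem zipWith_extAngle_tail (a : PlanarArc) (l : List PlanarArc) (b : PlanarArc) :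
    ((a :: l).map turning).sum + (List.zipWith extAngle (a :: l) (l ++ [b])).sum =
      pathTurning (a :: l) + (b.vel 0 / lastVel (a :: l)).arg := by
  induction l generalizing a with
  | nil => simp [pathTurning, lastVel, extAngle]
  | cons c l ih =>
    have := ih c
    simp only [List.map_cons, List.sum_cons, List.cons_append, List.zipWith_cons_cons,
      pathTurning, lastVel] at this ⊢
    linarith

/-- Only the closing corner separates the closed from the open turning, so a closed curve can be
analysed by cutting it into a path and a piece of `∂T`. -/
theorem totalTurning_eq {l : List PlanarArc} (hl : l ≠ []) :
    totalTurning l = pathTurning l + (headVel l / lastVel l).arg := by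
  cases l with
  | nil => exact absurd rfl hl
  | cons a l =>
    rw [totalTurning, List.rotate_cons_succ, List.rotate_zero]
    exact zipWith_extAngle_tail a l a

theorem totalTurning_eq_rotationNumber (l : List PlanarArc) :
    totalTurning l = 2 * Real.pi * rotationNumber l := (exists_rotationNumber l).choose_spec

/-- The turning along a sequence of arcs joined by chains of arcs. -/
theorem pathTurning_joined (n : ℕ) (arc : Fin (n + 1) → PlanarArc)
    (join : Fin n → List PlanarArc) (hj : ∀ k, join k ≠ []) :
    pathTurning (arc 0 :: (List.finRange n).flatMap fun k => join k ++ [arc k.succ]) =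
      ∑ k, (arc k).turning + ∑ k, ((headVel (join k) / (arc k.castSucc).vel 1).arg +
        pathTurning (join k) + ((arc k.succ).vel 0 / lastVel (join k)).arg) ∧
    lastVel (arc 0 :: (List.finRange n).flatMap fun k => join k ++ [arc k.succ]) =
      (arc (Fin.last n)).vel 1 := by
  induction n with
  | zero => simp [pathTurning, lastVel]
  | succ n ih =>
    obtain ⟨ih1, ih2⟩ := ih (fun k => arc k.castSucc) (fun k => join k.castSucc) fun k => hj _
    have hsplit : (arc 0 :: (List.finRange (n + 1)).flatMap fun k => join k ++ [arc k.succ]) =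
        (arc 0 :: (List.finRange n).flatMap fun k =>
          join k.castSucc ++ [arc k.castSucc.succ]) ++
        (join (Fin.last n) ++ [arc (Fin.last n).succ]) := by
      rw [List.finRange_succ_last]
      simp [List.flatMap_append, List.flatMap_map]
    have hne := hj (Fin.last n)
    simp only [Fin.castSucc_zero, ← Fin.succ_castSucc] at ih1 ih2
    rw [hsplit]
    constructor
    · rw [pathTurning_append (by simp) (by simp), ih1, ih2, headVel_append _ hne,
        pathTurning_append hne (by simp), Fin.sum_univ_castSucc (n := n + 1),
        Fin.sum_univ_castSucc (n := n) (f := fun k => _ + pathTurning (join k) + _),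
        show headVel [arc (Fin.last n).succ] = (arc (Fin.last n).succ).vel 0 from rfl,
        show pathTurning [arc (Fin.last n).succ] = (arc (Fin.last n).succ).turning from rfl,
        Fin.succ_last]
      ring
    · rw [lastVel_append _ (by simp), lastVel_append _ (by simp)]
      simp [lastVel]

end PlanarArc

/-! ### Exterior angles -/

theorem arg_smul_div_smul {r s : ℝ} (hr : 0 < r) (hs : 0 < s) (z w : ℂ) :
    (r * z / (s * w)).arg = (z / w).arg := by
  have : (r * z / (s * w) : ℂ) = ((r / s : ℝ) : ℂ) * (z / w) := by
    push_cast
    rw [mul_div_mul_comm]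
  rw [this, Complex.arg_real_mul _ (by positivity)]

theorem im_div_eq (z w : ℂ) : (z / w).im = (conj w * z).im / Complex.normSq w := by
  rw [Complex.div_im]
  simp
  ring

/-- If `z` has argument `θ` in `(0, π)`, then `-z⁻¹` has the direction of angle `π - θ`, again in
the principal range. In the lower half plane the principal value is `-π - θ` instead. -/
theorem arg_add_arg_neg_inv_of_im_pos {z : ℂ} (hz : 0 < z.im) :
    z.arg + (-z⁻¹).arg = Real.pi := by
  have h1 : (z⁻¹).im < 0 := by
    rw [Complex.inv_im]
    have : 0 < Complex.normSq z := Complex.normSq_pos.mpr (by rintro rfl; simp at hz)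
    exact div_neg_of_neg_of_pos (by linarith) this
  have h2 : z.arg ≠ Real.pi := by
    intro h
    rw [Complex.arg_eq_pi_iff] at h
    linarith [h.2]
  rw [Complex.arg_neg_eq_arg_add_pi_of_im_neg h1, Complex.arg_inv, if_neg h2]
  ring

theorem arg_add_arg_neg_inv_of_im_neg {z : ℂ} (hz : z.im < 0) :
    z.arg + (-z⁻¹).arg = -Real.pi := by
  have h1 : 0 < (z⁻¹).im := by
    rw [Complex.inv_im]
    have : 0 < Complex.normSq z := Complex.normSq_pos.mpr (by rintro rfl; simp at hz)
    exact div_pos (by linarith) this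
  have h2 : z.arg ≠ Real.pi := by
    intro h
    rw [Complex.arg_eq_pi_iff] at h
    linarith [h.2]
  rw [Complex.arg_neg_eq_arg_sub_pi_of_im_pos h1, Complex.arg_inv, if_neg h2]
  ring

/-- Two corners at which a line in direction `u` is left and entered in opposite directions. -/
theorem arg_div_add_arg_neg_div_of_im_pos {u t : ℂ} (h : 0 < (conj t * u).im) :
    (u / t).arg + (t / -u).arg = Real.pi := by
  have ht : t ≠ 0 := by rintro rfl; simp at h
  have : 0 < (u / t).im := by
    rw [im_div_eq]
    exact div_pos h (Complex.normSq_pos.mpr ht)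
  rw [← arg_add_arg_neg_inv_of_im_pos this, inv_div, div_neg]

theorem arg_div_add_arg_neg_div_of_im_neg {u t : ℂ} (h : (conj t * u).im < 0) :
    (u / t).arg + (t / -u).arg = -Real.pi := by
  have ht : t ≠ 0 := by rintro rfl; simp at h
  have : (u / t).im < 0 := by
    rw [im_div_eq]
    exact div_neg_of_neg_of_pos h (Complex.normSq_pos.mpr ht)
  rw [← arg_add_arg_neg_inv_of_im_neg this, inv_div, div_neg]

/-! ### Sides of the polygon -/

theorem polygonCorner_sub_one {g : ℕ} (hg : 0 < g) (k : ℤ) :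
    polygonCorner g (k - 1) =
      Complex.exp (((-(2 * Real.pi / (4 * g)) : ℝ) : ℂ) * Complex.I) * polygonCorner g k := by
  have hg' : (g : ℂ) ≠ 0 := by exact_mod_cast hg.ne'
  rw [polygonCorner, polygonCorner, ← Complex.exp_add]
  congr 1
  push_cast
  field_simp
  ring

theorem polygonCorner_add_period (g : ℕ) (k n : ℤ) (hg : 0 < g) :
    polygonCorner g (k + 4 * g * n) = polygonCorner g k := by
  have hg' : (g : ℂ) ≠ 0 := by exact_mod_cast hg.ne'
  rw [polygonCorner, polygonCorner, Complex.exp_eq_exp_iff_exists_int]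
  refine ⟨n, ?_⟩
  push_cast
  field_simp

/-- The direction of the side from corner `k` to corner `k + 1`. -/
noncomputable def sideVec (g : ℕ) (k : ℤ) : ℂ := polygonCorner g (k + 1) - polygonCorner g k

theorem sideVec_sub_one {g : ℕ} (hg : 0 < g) (k : ℤ) :
    sideVec g (k - 1) =
      Complex.exp (((-(2 * Real.pi / (4 * g)) : ℝ) : ℂ) * Complex.I) * sideVec g k := by
  rw [sideVec, sideVec, mul_sub, ← polygonCorner_sub_one hg, ← polygonCorner_sub_one hg]
  ring_nf

theorem sideVec_eq_of_modEq {g : ℕ} (hg : 0 < g) {k l : ℤ} (h : k ≡ l [ZMOD (4 * g : ℕ)]) :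
    sideVec g k = sideVec g l := by
  obtain ⟨n, hn⟩ := h.dvd
  obtain rfl : l = k + 4 * g * n := by push_cast at hn; linarith
  rw [sideVec, sideVec, polygonCorner_add_period g k n hg,
    show k + 4 * g * n + 1 = (k + 1) + 4 * g * n by ring, polygonCorner_add_period g _ n hg]

theorem arg_sideVec_div {g : ℕ} (hg : 0 < g) (k : ℤ) :
    (sideVec g (k - 1) / sideVec g k).arg = -(2 * Real.pi / (4 * g)) := by
  have hg' : (1 : ℝ) ≤ g := by exact_mod_cast hg
  have h0 : sideVec g k ≠ 0 := PuncturedPolygon.side_ne g hg k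
  rw [sideVec_sub_one hg, mul_div_assoc, div_self h0, mul_one, Complex.arg_exp_mul_I,
    toIocMod_eq_self]
  have hpi := Real.pi_pos
  -- The rotation angle is at most `π / 2` in size, so it is its own principal value.
  have h1 : 2 * Real.pi / (4 * g) ≤ 2 * Real.pi / 4 := by
    apply div_le_div_of_nonneg_left <;> linarith
  have h2 : 0 < 2 * Real.pi / (4 * g) := by positivity
  constructor <;> linarith

namespace PuncturedPolygon

open PlanarArc

variable {D : PuncturedPolygon}

theorem sideArc_vel (g : ℕ) (hg : 0 < g) (k : ℤ) (a b : ℝ) (hab : a ≠ b) (t : ℝ) :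
    (sideArc g hg k a b hab).vel t = ((b - a : ℝ) : ℂ) * sideVec g k := by
  have h1 : HasDerivAt (fun t : ℝ => a + (b - a) * t) (b - a) t := by
    simpa using ((hasDerivAt_id t).const_mul (b - a)).const_add a
  have h2 := ((h1.ofReal_comp).mul_const
    (polygonCorner g (k + 1) - polygonCorner g k)).const_add (polygonCorner g k)
  exact h2.deriv

theorem sideArc_turning (g : ℕ) (hg : 0 < g) (k : ℤ) (a b : ℝ) (hab : a ≠ b) :
    (sideArc g hg k a b hab).turning = 0 := by
  have hv := sideArc_vel g hg k a b hab
  rw [turning_eq _ (fun _ => (((b - a : ℝ) : ℂ) * sideVec g k).arg)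
    (fun _ => ‖((b - a : ℝ) : ℂ) * sideVec g k‖) continuousOn_const, sub_self]
  · intro t ht
    rw [← hv t, norm_pos_iff]
    exact (sideArc g hg k a b hab).regular t ht
  · intro t _
    rw [hv, Complex.norm_mul_exp_arg_mul_I]

/-- The angle of a corner of the polygon, passed clockwise. -/
theorem extAngle_sideArc {g : ℕ} (hg : 0 < g) (k : ℤ) {a b a' b' : ℝ} (hab : b < a)
    (hab' : b' < a') {z w : ℂ} (hz : z = ((b - a : ℝ) : ℂ) * sideVec g k)
    (hw : w = ((b' - a' : ℝ) : ℂ) * sideVec g (k - 1)) :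
    (w / z).arg = -(2 * Real.pi / (4 * g)) := by
  rw [hz, hw, ← arg_sideVec_div hg k,
    ← arg_smul_div_smul (r := a' - b') (s := a - b) (by linarith) (by linarith)
      (sideVec g (k - 1)) (sideVec g k)]
  congr 1
  push_cast
  rw [← neg_sub (b' : ℂ), ← neg_sub (b : ℂ), neg_mul, neg_mul, neg_div_neg_eq]

theorem pathTurning_sides {g : ℕ} (hg : 0 < g) (k : ℤ) {a : ℝ} (ha : 0 < a) (n : ℕ) :
    pathTurning (sideArc g hg k a 0 ha.ne' :: (List.range n).map (fun m : ℕ =>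
      sideArc g hg (k - (m + 1 : ℕ)) 1 0 one_ne_zero)) = n * -(2 * Real.pi / (4 * g)) ∧
    ∃ b > 0, lastVel (sideArc g hg k a 0 ha.ne' :: (List.range n).map (fun m : ℕ =>
      sideArc g hg (k - (m + 1 : ℕ)) 1 0 one_ne_zero)) =
        ((0 - b : ℝ) : ℂ) * sideVec g (k - n) := by
  induction n with
  | zero =>
    refine ⟨by simp [pathTurning, sideArc_turning], a, ha, ?_⟩
    simp [lastVel, sideArc_vel]
  | succ n ih =>
    obtain ⟨ih1, b, hb, ih2⟩ := ih
    rw [List.range_succ, List.map_append, ← List.cons_append, List.map_singleton]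
    constructor
    · rw [pathTurning_append (by simp) (by simp), ih1, ih2,
        extAngle_sideArc hg (k - n) (a := b) (b := 0) (a' := 1) (b' := 0) hb one_pos rfl]
      · simp only [pathTurning, sideArc_turning]
        push_cast
        ring
      · simp only [headVel, sideArc_vel]
        congr 2
        push_cast
        ring
    · refine ⟨1, one_pos, ?_⟩
      rw [lastVel_append _ (by simp)]
      simp [lastVel, sideArc_vel]

/-! ### Turning at a crossing of a polygon side -/

namespace Crossing

theorem steps_pos (x : D.Crossing) : 0 < x.steps := by
  have h1 := x.side.2
  have h2 := (D.pair x.side).2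
  have h3 : (D.pair x.side : ℕ) ≠ x.side := fun h => D.pair_ne _ (Fin.ext h)
  rw [steps]
  rcases lt_or_gt_of_ne h3 with h | h
  · rw [Nat.mod_eq_sub_mod (by omega), Nat.mod_eq_of_lt (by omega)]
    omega
  · rw [Nat.mod_eq_of_lt (by omega)]
    omega

/-- Going clockwise from exit to entry and on clockwise back to the exit runs once around the
polygon. Since a side is never glued to itself, neither remainder degenerates to zero. -/
theorem steps_add_reverse (x : D.Crossing) : x.steps + x.reverse.steps = 4 * D.genus := by
  have h1 := x.side.2
  have h2 := (D.pair x.side).2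
  have h3 : (D.pair x.side : ℕ) ≠ x.side := fun h => D.pair_ne _ (Fin.ext h)
  simp only [steps, reverse, D.pair_pair]
  rcases lt_or_gt_of_ne h3 with h | h
  · rw [Nat.mod_eq_sub_mod (by omega), Nat.mod_eq_of_lt (by omega), Nat.mod_eq_of_lt (by omega)]
    omega
  · rw [Nat.mod_eq_of_lt (by omega), Nat.mod_eq_sub_mod (by omega), Nat.mod_eq_of_lt (by omega)]
    omega

/-- The detour counts sides down without reducing the index, so the side it ends on agrees with the
paired side only modulo `4g`. -/
theorem sideVec_pair (x : D.Crossing) :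
    sideVec D.genus (D.pair x.side : ℕ) = sideVec D.genus ((x.side : ℕ) - (x.steps : ℕ)) := by
  apply sideVec_eq_of_modEq x.genus_pos
  have h2 := (D.pair x.side).2
  have h : (x.steps : ℤ) ≡ (x.side : ℕ) + (4 * D.genus : ℕ) - (D.pair x.side : ℕ)
      [ZMOD (4 * D.genus : ℕ)] := by
    rw [steps, Int.natCast_mod, Nat.cast_sub (by omega), Nat.cast_add]
    exact Int.mod_modEq _ _
  have h' := (Int.ModEq.refl ((x.side : ℕ) : ℤ)).sub h
  refine Int.ModEq.trans ?_ h'.symm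
  rw [Int.modEq_iff_dvd]
  exact ⟨-1, by ring⟩

theorem detour_ne_nil (x : D.Crossing) : x.detour ≠ [] := by simp [detour]

theorem headVel_detour (x : D.Crossing) :
    headVel x.detour = (x.param : ℂ) * -sideVec D.genus (x.side : ℕ) := by
  simp [detour, headVel, sideArc_vel]

theorem lastVel_detour (x : D.Crossing) :
    lastVel x.detour = (x.param : ℂ) * -sideVec D.genus (D.pair x.side : ℕ) := by
  rw [detour, lastVel_append _ (by simp)]
  simp [lastVel, sideArc_vel]

/-- The sides are straight; all turning happens at the corners passed, each by `-2π/(4g)`. -/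
theorem pathTurning_detour (x : D.Crossing) :
    pathTurning x.detour = x.steps * -(2 * Real.pi / (4 * D.genus)) := by
  obtain ⟨h1, b, hb, h2⟩ := pathTurning_sides x.genus_pos (x.side : ℕ) x.param_pos (x.steps - 1)
  have hs := x.steps_pos
  rw [detour, pathTurning_append (by simp) (by simp), h1, h2,
    extAngle_sideArc x.genus_pos ((x.side : ℕ) - (x.steps - 1 : ℕ)) (a := b) (b := 0) (a' := 1)
      (b' := 1 - x.param) hb (by linarith [x.param_pos]) rfl]
  · simp only [pathTurning, sideArc_turning]
    rw [Nat.cast_sub hs]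
    push_cast
    ring
  · simp only [headVel, sideArc_vel, x.sideVec_pair]
    congr 2
    rw [Nat.cast_sub hs]
    push_cast
    ring

/-- A crossing and its reverse together contribute two clockwise turns. -/
theorem turning_add_reverse (x : D.Crossing) {u v : ℂ}
    (hu : (conj x.sideDir * u).im < 0) (hv : 0 < (conj x.reverse.sideDir * v).im) :
    ((headVel x.detour / u).arg + pathTurning x.detour + (v / lastVel x.detour).arg) +
    ((headVel x.reverse.detour / -v).arg + pathTurning x.reverse.detour +
      (-u / lastVel x.reverse.detour).arg) = -(4 * Real.pi) := by
  have hp := x.param_pos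
  have hp' := x.reverse.param_pos
  have hg : (D.genus : ℝ) ≠ 0 := by exact_mod_cast x.genus_pos.ne'
  have hone (z : ℂ) : ((1 : ℝ) : ℂ) * z = z := by simp
  have a1 : (headVel x.detour / u).arg = (-sideVec D.genus (x.side : ℕ) / u).arg := by
    rw [headVel_detour, ← hone u, arg_smul_div_smul hp one_pos, hone]
  have a2 : (v / lastVel x.detour).arg = (v / -sideVec D.genus (D.pair x.side : ℕ)).arg := by
    rw [lastVel_detour, ← hone v, arg_smul_div_smul one_pos hp, hone]
  have a3 : (headVel x.reverse.detour / -v).arg =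
      (-sideVec D.genus (D.pair x.side : ℕ) / -v).arg := by
    rw [headVel_detour, ← hone (-v), arg_smul_div_smul hp' one_pos, hone]
    rfl
  have a4 : (-u / lastVel x.reverse.detour).arg =
      (-u / -sideVec D.genus (x.side : ℕ)).arg := by
    rw [lastVel_detour, ← hone (-u), arg_smul_div_smul one_pos hp', hone]
    simp only [reverse, D.pair_pair]
  -- The four corners with the sides are paired by side, not by traversal: leaving through a side in
  -- one direction goes with re-entering through that side in the other. Each pair gives `-π`, and
  -- the two detours together give the remaining `-2π`.
  have b1 := arg_div_add_arg_neg_div_of_im_neg hu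
  have hv' : (conj v * x.reverse.sideDir).im < 0 := by
    have : (conj v * x.reverse.sideDir).im = -(conj x.reverse.sideDir * v).im := by
      simp; ring
    linarith
  have b2 := arg_div_add_arg_neg_div_of_im_neg hv'
  have e1 : x.sideDir = sideVec D.genus (x.side : ℕ) := rfl
  have e2 : x.reverse.sideDir = sideVec D.genus (D.pair x.side : ℕ) := rfl
  rw [e1, div_neg, ← neg_div] at b1
  rw [e2] at b2
  have hsum : (x.steps : ℝ) + x.reverse.steps = 4 * D.genus := by
    exact_mod_cast x.steps_add_reverse
  rw [a1, a2, a3, a4, pathTurning_detour, pathTurning_detour, neg_div_neg_eq, neg_div_neg_eq]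
  have hd : (x.steps : ℝ) * -(2 * Real.pi / (4 * D.genus)) +
      x.reverse.steps * -(2 * Real.pi / (4 * D.genus)) = -(2 * Real.pi) := by
    rw [← add_mul, hsum]
    field_simp
  linarith

end Crossing

/-! ### A drawn curve and its reverse -/

namespace Curve

theorem drawn_ne_nil (c : D.Curve) : c.drawn ≠ [] := by simp [drawn]

theorem headVel_drawn (c : D.Curve) : headVel c.drawn = c.startDir := rfl

theorem lastVel_drawn (c : D.Curve) : lastVel c.drawn = c.finishDir :=
  (pathTurning_joined c.num c.arc (fun k => (c.cross k).detour) fun _ => Crossing.detour_ne_nil _).2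

theorem pathTurning_drawn (c : D.Curve) : pathTurning c.drawn =
    ∑ k, (c.arc k).turning + ∑ k, ((headVel (c.cross k).detour / (c.arc k.castSucc).vel 1).arg +
      pathTurning (c.cross k).detour + ((c.arc k.succ).vel 0 / lastVel (c.cross k).detour).arg) :=
  (pathTurning_joined c.num c.arc (fun k => (c.cross k).detour)
    fun _ => Crossing.detour_ne_nil _).1

theorem startDir_ne_zero (c : D.Curve) : c.startDir ≠ 0 := (c.arc 0).vel_zero_ne

theorem finishDir_ne_zero (c : D.Curve) : c.finishDir ≠ 0 := (c.arc _).vel_one_ne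

theorem reverse_start (c : D.Curve) : c.reverse.start = c.finish := by
  change ((c.arc (Fin.rev (0 : Fin (c.num + 1)))).reverse).start = _
  simp [finish, PlanarArc.start, PlanarArc.finish, PlanarArc.reverse]

theorem reverse_finish (c : D.Curve) : c.reverse.finish = c.start := by
  simp [start, finish, reverse, PlanarArc.start, PlanarArc.finish, PlanarArc.reverse]

theorem reverse_startDir (c : D.Curve) : c.reverse.startDir = -c.finishDir := by
  change ((c.arc (Fin.rev (0 : Fin (c.num + 1)))).reverse).vel 0 = _
  simp [finishDir, reverse_vel]

theorem reverse_finishDir (c : D.Curve) : c.reverse.finishDir = -c.startDir := by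
  simp [startDir, finishDir, reverse, reverse_vel]

/-- A curve and its reverse, drawn in the plane, together make two clockwise turns for every
crossing of a side. -/
theorem pathTurning_drawn_add_reverse {c : D.Curve} (hc : c.IsEmbedded) :
    pathTurning c.drawn + pathTurning c.reverse.drawn = -(4 * Real.pi) * c.num := by
  have h1 : ∑ k, (c.reverse.arc k).turning = -∑ k, (c.arc k).turning := by
    change ∑ k : Fin (c.num + 1), (c.arc k.rev).reverse.turning = _
    rw [← Finset.sum_neg_distrib, ← Equiv.sum_comp Fin.revPerm]
    exact Finset.sum_congr rfl fun k _ => by simp [reverse_turning]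
  -- The crossings of the reversed curve are reindexed so that each one stands beside the original
  -- crossing that it reverses.
  have h2 : ∑ k, ((headVel (c.reverse.cross k).detour / (c.reverse.arc k.castSucc).vel 1).arg +
      pathTurning (c.reverse.cross k).detour +
        ((c.reverse.arc k.succ).vel 0 / lastVel (c.reverse.cross k).detour).arg) =
      ∑ k : Fin c.num, ((headVel (c.cross k).reverse.detour / -(c.arc k.succ).vel 0).arg +
      pathTurning (c.cross k).reverse.detour +
        (-(c.arc k.castSucc).vel 1 / lastVel (c.cross k).reverse.detour).arg) := by
    rw [← Equiv.sum_comp (Fin.revPerm (n := c.num))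
      (fun k => (headVel (c.cross k).reverse.detour / -(c.arc k.succ).vel 0).arg + _ + _)]
    refine Finset.sum_congr rfl fun (k : Fin c.num) _ => ?_
    change (headVel (c.cross k.rev).reverse.detour / (c.arc k.castSucc.rev).reverse.vel 1).arg +
      pathTurning (c.cross k.rev).reverse.detour +
      ((c.arc k.succ.rev).reverse.vel 0 / lastVel (c.cross k.rev).reverse.detour).arg = _
    simp only [reverse_vel, Fin.revPerm_apply, sub_self, sub_zero, Fin.rev_castSucc, Fin.rev_succ]
  rw [pathTurning_drawn, pathTurning_drawn, h1, h2]
  have h3 : ∀ a b d : ℝ, a + b + (-a + d) = b + d := fun a b d => by ring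
  rw [h3]
  refine Finset.sum_add_distrib.symm.trans ?_
  rw [Finset.sum_congr rfl fun k _ => (c.cross k).turning_add_reverse (hc.exit_transversal k)
    (hc.entry_transversal k)]
  simp
  ring

end Curve

/-! ### Boundary circles -/

/-- The tangent vector of the boundary circle `c` at `z` that has the surface to its left if
`σ = 1` and to its right if `σ = -1`. -/
noncomputable def Component.tangent (c : D.Component) (σ : ℤˣ) (z : ℂ) : ℂ :=
  ((((σ : ℤ) : ℝ) * c.sign : ℝ) : ℂ) * (Complex.I * (z - c.center))

theorem Component.sign_eq (c : D.Component) : c.sign = 1 ∨ c.sign = -1 := by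
  rcases c with ⟨_ | h, hc⟩ <;> simp [Component.sign]

theorem orient_mul_sign_eq (σ : ℤˣ) (c : D.Component) :
    ((σ : ℤ) : ℝ) * c.sign = 1 ∨ ((σ : ℤ) : ℝ) * c.sign = -1 := by
  rcases c.sign_eq with h | h <;> rcases Int.units_eq_one_or σ with rfl | rfl <;> simp [h]

/-- The direction depends only on the circle and the point, because `ℓ` is positive. Hence
consecutive arcs of a circle meet at exterior angle zero. -/
theorem circleArc_vel (σ : ℤˣ) (c : D.Component) (a ℓ : ℝ) (hℓ : 0 < ℓ) (t : ℝ) :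
    (circleArc σ c a ℓ hℓ).vel t = (ℓ : ℂ) * c.tangent σ ((circleArc σ c a ℓ hℓ).toFun t) := by
  have h1 : HasDerivAt (fun t : ℝ => a + ((σ : ℤ) : ℝ) * c.sign * ℓ * t)
      (((σ : ℤ) : ℝ) * c.sign * ℓ) t := by
    simpa using ((hasDerivAt_id t).const_mul (((σ : ℤ) : ℝ) * c.sign * ℓ)).const_add a
  have h2 := (((h1.ofReal_comp).mul_const Complex.I).cexp.const_mul
    (c.radius : ℂ)).const_add c.center
  refine h2.deriv.trans ?_
  simp only [Component.tangent, circleArc]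
  push_cast
  ring

theorem circleArc_turning (σ : ℤˣ) (c : D.Component) (a ℓ : ℝ) (hℓ : 0 < ℓ) :
    (circleArc σ c a ℓ hℓ).turning = ((σ : ℤ) : ℝ) * c.sign * ℓ := by
  have hr := c.radius_pos
  rw [turning_eq _ (fun t => a + ((σ : ℤ) : ℝ) * c.sign * ℓ * t +
    ((σ : ℤ) : ℝ) * c.sign * (Real.pi / 2)) (fun _ => ℓ * c.radius)]
  · ring
  · fun_prop
  · intro t _
    positivity
  · intro t _
    rw [circleArc_vel]
    simp only [Component.tangent, circleArc]
    -- The tangent is the radius vector turned by a right angle to the side given by the sign `σ *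
    -- c.sign`.
    have hI : Complex.exp (((((σ : ℤ) : ℝ) * c.sign * (Real.pi / 2) : ℝ) : ℂ) * Complex.I) =
        ((((σ : ℤ) : ℝ) * c.sign : ℝ) : ℂ) * Complex.I := by
      rcases orient_mul_sign_eq σ c with h | h
      · rw [h]
        push_cast
        rw [one_mul, one_mul, Complex.exp_pi_div_two_mul_I]
      · rw [h]
        push_cast
        rw [neg_one_mul, neg_one_mul, neg_mul, Complex.exp_neg, Complex.exp_pi_div_two_mul_I,
          Complex.inv_I]
    rw [Complex.ofReal_add (a + _), add_mul (((a + _ : ℝ)) : ℂ), Complex.exp_add, hI]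
    push_cast
    ring

theorem Component.orient_mul_im_tangent (c : D.Component) (σ : ℤˣ) {z u : ℂ}
    (h : c.PointsInward z u) : 0 < ((σ : ℤ) : ℝ) * (conj (c.tangent σ z) * u).im := by
  have hσ : ((σ : ℤ) : ℝ) * ((σ : ℤ) : ℝ) = 1 := by
    rcases Int.units_eq_one_or σ with rfl | rfl <;> simp
  have : ((σ : ℤ) : ℝ) * (conj (c.tangent σ z) * u).im =
      (((σ : ℤ) : ℝ) * ((σ : ℤ) : ℝ)) * -(c.sign * (conj (z - c.center) * u).re) := by
    simp [Component.tangent]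
    ring
  rw [this, hσ, one_mul]
  exact neg_pos.mpr h

/-- The corners at which the boundary turns into the two sides of a cut at one of its ends. -/
theorem Component.arg_corners (c : D.Component) (σ : ℤˣ) {z u : ℂ} (h : c.PointsInward z u) :
    (u / c.tangent σ z).arg + (c.tangent σ z / -u).arg = ((σ : ℤ) : ℝ) * Real.pi := by
  have := c.orient_mul_im_tangent σ h
  rcases Int.units_eq_one_or σ with rfl | rfl
  · rw [arg_div_add_arg_neg_div_of_im_pos (by simpa using this)]
    simp
  · rw [arg_div_add_arg_neg_div_of_im_neg (by simpa using this)]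
    simp

/-- Needed so that a junction point alone determines the circle, and thus the tangent there. -/
theorem Component.eq_of_mem_circle {c c' : D.Component} {z : ℂ} (h : z ∈ c.circle)
    (h' : z ∈ c'.circle) : c = c' := by
  have key : ∀ (k : Fin D.holes), D.genus = 0 → z ∈ Metric.sphere (D.center k) (D.radius k) →
      z ∉ Metric.sphere (0 : ℂ) 1 := by
    intro k hg hz hz'
    have := D.hole_subset k (Metric.sphere_subset_closedBall hz)
    rw [openFace, if_pos hg] at this
    rw [mem_sphere_zero_iff_norm] at hz'
    rw [mem_ball_zero_iff] at this
    linarith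
  rcases c with ⟨_ | k, hc⟩ <;> rcases c' with ⟨_ | k', hc'⟩
  · rfl
  · exact absurd h (key k' (hc rfl) h')
  · exact absurd h' (key k (hc' rfl) h)
  · have : k = k' := by
      by_contra hne
      exact (D.hole_disjoint k k' hne).le_bot ⟨Metric.sphere_subset_closedBall h,
        Metric.sphere_subset_closedBall h'⟩
    subst this
    rfl

theorem circleArc_mem_circle (σ : ℤˣ) (c : D.Component) (a ℓ : ℝ) (hℓ : 0 < ℓ) (t : ℝ) :
    (circleArc σ c a ℓ hℓ).toFun t ∈ c.circle := by
  simp only [circleArc, Component.circle, mem_sphere_iff_norm, add_sub_cancel_left, norm_mul,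
    Complex.norm_exp_ofReal_mul_I, mul_one, Complex.norm_real]
  exact Real.norm_of_nonneg c.radius_pos.le

end PuncturedPolygon

open MeasureTheory in
/-- Half-open arcs that cover a circle exactly once have total angular length `2π`. -/
theorem sum_angular_length {ι : Type*} [Fintype ι] (a ℓ : ι → ℝ) (s : ℝ) (hs : s = 1 ∨ s = -1)
    (h : ∀ θ : ℝ, ∃! p : ι × ℝ, p.2 ∈ Ico (0 : ℝ) 1 ∧
      ∃ n : ℤ, a p.1 + s * ℓ p.1 * p.2 = θ + n * (2 * Real.pi))
    (hℓ : ∀ i, 0 < ℓ i) : ∑ i, ℓ i = 2 * Real.pi := by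
  let J : ι → Set ℝ := fun i => (fun t => a i + s * ℓ i * t) '' Ico (0 : ℝ) 1
  have hJ : ∀ i, J i = if s = 1 then Ico (a i) (a i + ℓ i) else Ioc (a i - ℓ i) (a i) := by
    intro i
    have hi := hℓ i
    ext x
    rcases hs with rfl | rfl
    · rw [if_pos rfl]
      constructor
      · rintro ⟨t, ⟨ht0, ht1⟩, rfl⟩
        constructor <;> simp only <;> nlinarith
      · rintro ⟨h0, h1⟩
        refine ⟨(x - a i) / ℓ i, ⟨div_nonneg (by linarith) hi.le, ?_⟩, ?_⟩
        · rw [div_lt_one hi]; linarith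
        · field_simp; ring
    · rw [if_neg (by norm_num)]
      constructor
      · rintro ⟨t, ⟨ht0, ht1⟩, rfl⟩
        constructor <;> simp only <;> nlinarith
      · rintro ⟨h0, h1⟩
        refine ⟨(a i - x) / ℓ i, ⟨div_nonneg (by linarith) hi.le, ?_⟩, ?_⟩
        · rw [div_lt_one hi]; linarith
        · field_simp; ring
  have hmeas : ∀ i, MeasurableSet (J i) := by
    intro i
    rw [hJ]
    split_ifs
    · exact measurableSet_Ico
    · exact measurableSet_Ioc
  have hvol : ∀ i, volume (J i) = ENNReal.ofReal (ℓ i) := by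
    intro i
    rw [hJ]
    split_ifs
    · rw [Real.volume_Ico]; congr 1; ring
    · rw [Real.volume_Ioc]; congr 1; ring
  have hdisj : Pairwise (Function.onFun Disjoint J) := by
    intro i j hij
    refine Set.disjoint_left.mpr ?_
    rintro _ ⟨t, ht, rfl⟩ ⟨u, hu, hut⟩
    have := (h (a i + s * ℓ i * t)).unique (y₁ := (i, t)) (y₂ := (j, u))
      ⟨ht, 0, by simp⟩ ⟨hu, 0, by simpa using hut⟩
    exact hij (congrArg Prod.fst this)
  -- Covering every angle class exactly once means that the lifted arcs form a fundamental domain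
  -- for translation by `2π`. All such domains have the same measure, and `Ioc 0 (2π)` is one.
  have hfd : IsAddFundamentalDomain (AddSubgroup.zmultiples (2 * Real.pi)) (⋃ i, J i)
      (volume : Measure ℝ) := by
    refine IsAddFundamentalDomain.mk' (MeasurableSet.iUnion hmeas).nullMeasurableSet ?_
    intro x
    obtain ⟨⟨i, t⟩, ⟨ht, n, hn⟩, huniq⟩ := h x
    refine ⟨⟨n * (2 * Real.pi), n, by simp⟩, ?_, ?_⟩
    · change (n * (2 * Real.pi) : ℝ) + x ∈ ⋃ i, J i
      rw [mem_iUnion]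
      exact ⟨i, t, ht, by simp only at hn ⊢; linarith⟩
    · rintro ⟨y, m, rfl⟩ hy
      change (m • (2 * Real.pi) : ℝ) + x ∈ ⋃ i, J i at hy
      rw [mem_iUnion] at hy
      obtain ⟨j, u, hu, hju⟩ := hy
      have := huniq (j, u) ⟨hu, m, by simp only [zsmul_eq_mul] at hju ⊢; linarith⟩
      obtain ⟨rfl, rfl⟩ := Prod.mk.inj this
      apply Subtype.ext
      simp only [zsmul_eq_mul] at hju hn ⊢
      linarith
  have hm := hfd.measure_eq (isAddFundamentalDomain_Ioc (Real.two_pi_pos) 0 volume)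
  rw [measure_iUnion hdisj hmeas, tsum_fintype, Real.volume_Ioc] at hm
  simp only [hvol] at hm
  rw [← ENNReal.ofReal_sum_of_nonneg fun i _ => (hℓ i).le, zero_add, sub_zero,
    ENNReal.ofReal_eq_ofReal_iff (Finset.sum_nonneg fun i _ => (hℓ i).le)
      Real.two_pi_pos.le] at hm
  exact hm

open PlanarArc PuncturedPolygon

/-! ### Number of boundary components -/

namespace PuncturedPolygon

variable (D : PuncturedPolygon)

noncomputable instance : Fintype D.Component :=
  haveI : Finite D.Component :=
    inferInstanceAs (Finite {o : Option (Fin D.holes) // o = none → D.genus = 0})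
  Fintype.ofFinite _

theorem card_component : Fintype.card D.Component = D.numComponents := by
  classical
  have h : Fintype.card D.Component =
      Fintype.card {o : Option (Fin D.holes) // o = none → D.genus = 0} :=
    Fintype.card_congr (Equiv.refl _)
  rw [h, numComponents]
  by_cases hg : D.genus = 0
  · rw [Fintype.card_congr (Equiv.subtypeUnivEquiv fun _ _ => hg)]
    simp [hg]
  · rw [if_neg hg, add_zero, Fintype.card_subtype]
    have : (Finset.univ.filter fun o : Option (Fin D.holes) => o = none → D.genus = 0) =
        Finset.univ.map Function.Embedding.some := by
      ext o
      cases o <;> simp [hg]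
    rw [this, Finset.card_map, Finset.card_univ, Fintype.card_fin]

theorem numComponents_pos : 0 < D.numComponents := by
  rw [numComponents]
  rcases D.has_boundary with h | h
  · simp [h]
  · omega

end PuncturedPolygon

/-! ### Corners between pieces of the boundary of the cut surface -/

namespace BoundaryPiece

variable {D : PuncturedPolygon} (cuts : Fin (D.numComponents - 1) → D.Curve) (σ : ℤˣ)

theorem drawn_ne_nil (p : BoundaryPiece D) : p.drawn cuts σ ≠ [] := by
  cases p with
  | arc c a ℓ hℓ => simp [drawn]
  | cut k rev => exact Curve.drawn_ne_nil _

theorem headVel_arc {c c' : D.Component} {a ℓ : ℝ} (hℓ : 0 < ℓ)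
    (h : (arc c a ℓ hℓ).start cuts σ ∈ c'.circle) :
    headVel ((arc c a ℓ hℓ).drawn cuts σ) =
      ℓ * c'.tangent σ ((arc c a ℓ hℓ).start cuts σ) := by
  obtain rfl := Component.eq_of_mem_circle (circleArc_mem_circle σ c a ℓ hℓ 0) h
  exact circleArc_vel σ c a ℓ hℓ 0

theorem lastVel_arc {c c' : D.Component} {a ℓ : ℝ} (hℓ : 0 < ℓ)
    (h : (arc c a ℓ hℓ).finish cuts σ ∈ c'.circle) :
    lastVel ((arc c a ℓ hℓ).drawn cuts σ) =
      ℓ * c'.tangent σ ((arc c a ℓ hℓ).finish cuts σ) := by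
  obtain rfl := Component.eq_of_mem_circle (circleArc_mem_circle σ c a ℓ hℓ 1) h
  exact circleArc_vel σ c a ℓ hℓ 1

open Classical in
/-- The angular length of a piece on the circle `c`. -/
noncomputable def lengthOn (c : D.Component) : BoundaryPiece D → ℝ
  | arc c' _ ℓ _ => if c' = c then ℓ else 0
  | cut _ _ => 0

/-- The exterior angle where the boundary circle turns into a cut. -/
noncomputable def angleIn (comp : Fin (D.numComponents - 1) → Bool → D.Component) :
    BoundaryPiece D → ℝ
  | arc _ _ _ _ => 0
  | cut k rev => ((cutCurve cuts k rev).startDir /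
      (comp k rev).tangent σ (cutCurve cuts k rev).start).arg

/-- The exterior angle where a cut turns into the boundary circle. -/
noncomputable def angleOut (comp : Fin (D.numComponents - 1) → Bool → D.Component) :
    BoundaryPiece D → ℝ
  | arc _ _ _ _ => 0
  | cut k rev => ((comp k !rev).tangent σ (cutCurve cuts k rev).finish /
      (cutCurve cuts k rev).finishDir).arg

/-- The corner between two consecutive pieces. -/
theorem arg_corner {comp : Fin (D.numComponents - 1) → Bool → D.Component}
    (hs : ∀ k rev, (cutCurve cuts k rev).start ∈ (comp k rev).circle)
    (hf : ∀ k rev, (cutCurve cuts k rev).finish ∈ (comp k !rev).circle)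
    (p p' : BoundaryPiece D) (hj : p.finish cuts σ = p'.start cuts σ)
    (ha : ¬ (p.IsCut ∧ p'.IsCut)) :
    (headVel (p'.drawn cuts σ) / lastVel (p.drawn cuts σ)).arg =
      p.angleOut cuts σ comp + p'.angleIn cuts σ comp := by
  have hone (z : ℂ) : ((1 : ℝ) : ℂ) * z = z := by simp
  cases p with
  | arc c a ℓ hℓ =>
    cases p' with
    | arc c' a' ℓ' hℓ' =>
      have hm : (arc c a ℓ hℓ).finish cuts σ ∈ c'.circle := by
        rw [hj]
        exact circleArc_mem_circle σ c' a' ℓ' hℓ' 0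
      have h0 := lastVel_ne_zero ((arc c a ℓ hℓ).drawn cuts σ)
      rw [lastVel_arc cuts σ hℓ hm] at h0 ⊢
      rw [headVel_arc cuts σ hℓ' (circleArc_mem_circle σ c' a' ℓ' hℓ' 0), ← hj,
        arg_smul_div_smul hℓ' hℓ, div_self (right_ne_zero_of_mul h0)]
      simp [angleIn, angleOut]
    | cut k rev =>
      have hm : (arc c a ℓ hℓ).finish cuts σ ∈ (comp k rev).circle := by
        rw [hj]
        exact hs k rev
      rw [lastVel_arc cuts σ hℓ hm, hj, ← hone (headVel _), arg_smul_div_smul one_pos hℓ]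
      simp only [angleIn, angleOut, zero_add]
      rfl
  | cut k rev =>
    cases p' with
    | arc c' a' ℓ' hℓ' =>
      have hm : (arc c' a' ℓ' hℓ').start cuts σ ∈ (comp k !rev).circle := by
        rw [← hj]
        exact hf k rev
      rw [headVel_arc cuts σ hℓ' hm, ← hj, ← hone (lastVel _), arg_smul_div_smul hℓ' one_pos]
      simp only [angleIn, angleOut, add_zero, drawn, Curve.lastVel_drawn]
      rfl
    | cut k' rev' => exact absurd ⟨trivial, trivial⟩ ha

end BoundaryPiece

/-! ### Rotation number of the boundary of the cut surface -/

namespace CutSurface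

variable {D : PuncturedPolygon} {V E : Type*} {N : Network D V E} (T : CutSurface N)

/-- The pieces of the boundary, numbered cyclically. -/
def cyclicPiece (m : ℕ) : BoundaryPiece D := T.piece ⟨m % T.len, Nat.mod_lt _ T.len_pos⟩

noncomputable def cyclicDrawn (m : ℕ) : List PlanarArc :=
  (T.cyclicPiece m).drawn T.cuts T.orient

theorem cyclicPiece_add_len (m : ℕ) : T.cyclicPiece (m + T.len) = T.cyclicPiece m := by
  simp [cyclicPiece]

theorem cyclicPiece_val (m : Fin T.len) : T.cyclicPiece m = T.piece m := by
  simp [cyclicPiece, Nat.mod_eq_of_lt m.2]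

theorem cyclicDrawn_ne_nil (m : ℕ) : T.cyclicDrawn m ≠ [] := BoundaryPiece.drawn_ne_nil _ _ _

/-- The exterior angle between the piece `m` and the next one. -/
noncomputable def corner (m : ℕ) : ℝ :=
  (headVel (T.cyclicDrawn (m + 1)) / lastVel (T.cyclicDrawn m)).arg

/-- The turning along the first `n` pieces, including the corners at their ends. -/
noncomputable def turningTo (n : ℕ) : ℝ :=
  ∑ m ∈ Finset.range n, (pathTurning (T.cyclicDrawn m) + T.corner m)

theorem corner_add_len (m : ℕ) : T.corner (m + T.len) = T.corner m := by
  rw [corner, corner, show m + T.len + 1 = m + 1 + T.len by ring]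
  simp only [cyclicDrawn, cyclicPiece_add_len]

theorem turningTo_succ (n : ℕ) :
    T.turningTo (n + 1) = T.turningTo n + (pathTurning (T.cyclicDrawn n) + T.corner n) :=
  Finset.sum_range_succ _ _

/-- The summands are periodic, so a full circuit adds the same amount wherever it starts. -/
theorem turningTo_add_len (n : ℕ) :
    T.turningTo (n + T.len) = T.turningTo n + T.turningTo T.len := by
  induction n with
  | zero => simp [turningTo]
  | succ n ih =>
    rw [show n + 1 + T.len = n + T.len + 1 by ring, turningTo_succ, turningTo_succ, ih,
      corner_add_len, cyclicDrawn, cyclicPiece_add_len]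
    simp only [cyclicDrawn]
    ring

/-- The turning along consecutive pieces of the boundary. -/
theorem pathTurning_flatMap (p n : ℕ) :
    pathTurning ((List.range (n + 1)).flatMap fun m => T.cyclicDrawn (p + m)) =
      T.turningTo (p + (n + 1)) - T.turningTo p - T.corner (p + n) ∧
    headVel ((List.range (n + 1)).flatMap fun m => T.cyclicDrawn (p + m)) =
      headVel (T.cyclicDrawn p) ∧
    lastVel ((List.range (n + 1)).flatMap fun m => T.cyclicDrawn (p + m)) =
      lastVel (T.cyclicDrawn (p + n)) ∧
    (List.range (n + 1)).flatMap (fun m => T.cyclicDrawn (p + m)) ≠ [] := by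
  induction n with
  | zero =>
    have := T.cyclicDrawn_ne_nil p
    simp [turningTo_succ, this]
  | succ n ih =>
    obtain ⟨h1, h2, h3, h4⟩ := ih
    have hne := T.cyclicDrawn_ne_nil (p + (n + 1))
    rw [List.range_succ, List.flatMap_append, List.flatMap_singleton]
    refine ⟨?_, ?_, ?_, ?_⟩
    · rw [pathTurning_append h4 hne, h1, h3, ← add_assoc p (n + 1) 1, turningTo_succ]
      have : (headVel (T.cyclicDrawn (p + (n + 1))) / lastVel (T.cyclicDrawn (p + n))).arg =
        T.corner (p + n) := rfl
      rw [this]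
      ring
    · rw [headVel_append _ h4, h2]
    · rw [lastVel_append _ hne]
    · simp [h4]

/-- The boundary component on which a cut, followed in the given direction, starts. -/
theorem exists_cut_components : ∃ comp : Fin (D.numComponents - 1) → Bool → D.Component,
    (∀ k rev, (BoundaryPiece.cutCurve T.cuts k rev).start ∈ (comp k rev).circle) ∧
    (∀ k rev, (BoundaryPiece.cutCurve T.cuts k rev).finish ∈ (comp k !rev).circle) ∧
    (∀ k, (comp k false).PointsInward (T.cuts k).start (T.cuts k).startDir) ∧
    (∀ k, (comp k true).PointsInward (T.cuts k).finish (-(T.cuts k).finishDir)) := by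
  choose c c' _ h1 h2 h3 h4 using T.cuts_ends
  refine ⟨fun k rev => if rev then c' k else c k, ?_, ?_, ?_, ?_⟩
  · rintro k (_ | _) <;> simp [BoundaryPiece.cutCurve, Curve.reverse_start, h1, h2]
  · rintro k (_ | _) <;> simp [BoundaryPiece.cutCurve, Curve.reverse_finish, h1, h2]
  · simpa using h3
  · simpa using h4

/-- Exact covering of the circle by points translates into exact covering of angles modulo `2π`, to
which `sum_angular_length` applies. -/
theorem sum_lengthOn (c : D.Component) :
    ∑ m, (T.piece m).lengthOn c = 2 * Real.pi := by
  classical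
  have hex : ∀ m : {m // ∃ a ℓ hℓ, T.piece m = BoundaryPiece.arc c a ℓ hℓ},
    ∃ a ℓ hℓ, T.piece m = BoundaryPiece.arc c a ℓ hℓ := fun m => m.2
  choose a ℓ hℓ hp using hex
  rw [← sum_angular_length a ℓ (((T.orient : ℤ) : ℝ) * c.sign) (orient_mul_sign_eq _ _) ?_ hℓ]
  · rw [← Finset.sum_filter_of_ne
      (p := fun m => ∃ a ℓ hℓ, T.piece m = BoundaryPiece.arc c a ℓ hℓ),
      Finset.sum_subtype (p := fun m => ∃ a ℓ hℓ, T.piece m = BoundaryPiece.arc c a ℓ hℓ) _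
        (by simp)]
    · exact Finset.sum_congr rfl fun m _ => by rw [hp m]; simp [BoundaryPiece.lengthOn]
    · intro m _ hm
      cases h : T.piece m with
      | arc c' a₁ ℓ₁ hℓ₁ =>
        rw [h] at hm
        obtain rfl : c' = c := by
          by_contra hne
          simp [BoundaryPiece.lengthOn, hne] at hm
        exact ⟨a₁, ℓ₁, hℓ₁, rfl⟩
      | cut k rev =>
        rw [h] at hm
        simp [BoundaryPiece.lengthOn] at hm
  · intro θ
    have hiff : ∀ m t, (circleArc T.orient c (a m) (ℓ m) (hℓ m)).toFun t =
        c.center + c.radius * Complex.exp (θ * Complex.I) ↔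
        ∃ n : ℤ, a m + ((T.orient : ℤ) : ℝ) * c.sign * ℓ m * t = θ + n * (2 * Real.pi) := by
      intro m t
      have hr : (c.radius : ℂ) ≠ 0 := by exact_mod_cast c.radius_pos.ne'
      simp only [circleArc, add_right_inj, mul_right_inj' hr, Complex.exp_eq_exp_iff_exists_int]
      refine exists_congr fun n => ?_
      rw [show (θ * Complex.I + n * (2 * Real.pi * Complex.I) : ℂ) =
        ((θ + n * (2 * Real.pi) : ℝ) : ℂ) * Complex.I by push_cast; ring,
        mul_left_inj' Complex.I_ne_zero, Complex.ofReal_inj]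
    have hz : c.center + c.radius * Complex.exp (θ * Complex.I) ∈ c.circle := by
      simp only [Component.circle, mem_sphere_iff_norm, add_sub_cancel_left, norm_mul,
        Complex.norm_exp_ofReal_mul_I, mul_one, Complex.norm_real]
      exact Real.norm_of_nonneg c.radius_pos.le
    obtain ⟨⟨m, t⟩, ⟨ht, a', ℓ', hℓ', hm, htz⟩, huniq⟩ := T.circle_once c _ hz
    have hm' : ∃ a ℓ hℓ, T.piece m = BoundaryPiece.arc c a ℓ hℓ := ⟨a', ℓ', hℓ', hm⟩
    refine ⟨(⟨m, hm'⟩, t), ⟨ht, (hiff _ _).mp ?_⟩, ?_⟩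
    · have heq := (hp ⟨m, hm'⟩).symm.trans hm
      simp only [BoundaryPiece.arc.injEq, true_and] at heq
      simp only [heq.1, heq.2]
      exact htz
    · rintro ⟨m₁, t₁⟩ ⟨ht₁, hn₁⟩
      have := huniq (m₁, t₁) ⟨ht₁, _, _, _, hp m₁, (hiff _ _).mpr hn₁⟩
      obtain ⟨h1, h2⟩ := Prod.mk.inj this
      exact Prod.ext (Subtype.ext h1) h2

/-- The turning along a piece and the corners between cuts and boundary circles at its ends. -/
noncomputable def pieceTurning (comp : Fin (D.numComponents - 1) → Bool → D.Component)
    (p : BoundaryPiece D) : ℝ :=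
  pathTurning (p.drawn T.cuts T.orient) + p.angleOut T.cuts T.orient comp +
    p.angleIn T.cuts T.orient comp

/-- Each end of the cut contributes two corners with sum `σπ`, and each crossing contributes `-4π`;
the smooth turnings of the two sides cancel. -/
theorem pieceTurning_cut_add_reverse
    {comp : Fin (D.numComponents - 1) → Bool → D.Component} (k : Fin (D.numComponents - 1))
    (h1 : (comp k false).PointsInward (T.cuts k).start (T.cuts k).startDir)
    (h2 : (comp k true).PointsInward (T.cuts k).finish (-(T.cuts k).finishDir)) :
    T.pieceTurning comp (.cut k false) + T.pieceTurning comp (.cut k true) =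
      2 * Real.pi * (((T.orient : ℤ) : ℝ) - 2 * (T.cuts k).num) := by
  have e1 := (comp k false).arg_corners T.orient h1
  have e2 := (comp k true).arg_corners T.orient h2
  have e3 := Curve.pathTurning_drawn_add_reverse (T.cuts_embedded k)
  rw [neg_neg] at e2
  simp only [pieceTurning, BoundaryPiece.drawn, BoundaryPiece.angleIn, BoundaryPiece.angleOut,
    BoundaryPiece.cutCurve, if_true, Bool.false_eq_true, if_false, Bool.not_true, Bool.not_false,
    Curve.reverse_start, Curve.reverse_finish, Curve.reverse_startDir, Curve.reverse_finishDir]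
  linarith

/-- Every corner splits into an exit angle belonging to the earlier piece and an entry angle
belonging to the later one. Regrouping cyclically makes the total a sum over pieces that no longer
sees their order. -/
theorem turningTo_len_eq {comp : Fin (D.numComponents - 1) → Bool → D.Component}
    (hs : ∀ k rev, (BoundaryPiece.cutCurve T.cuts k rev).start ∈ (comp k rev).circle)
    (hf : ∀ k rev, (BoundaryPiece.cutCurve T.cuts k rev).finish ∈ (comp k !rev).circle) :
    T.turningTo T.len = ∑ m, T.pieceTurning comp (T.piece m) := by
  have hx : ∀ m, T.corner m = (T.cyclicPiece m).angleOut T.cuts T.orient comp +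
      (T.cyclicPiece (m + 1)).angleIn T.cuts T.orient comp := by
    intro m
    apply BoundaryPiece.arg_corner T.cuts T.orient hs hf
    · exact T.piece_joins _ _ (by simp)
    · exact T.piece_alternates _ _ (by simp)
  have hshift : ∑ m ∈ Finset.range T.len,
      (T.cyclicPiece (m + 1)).angleIn T.cuts T.orient comp =
      ∑ m ∈ Finset.range T.len, (T.cyclicPiece m).angleIn T.cuts T.orient comp := by
    have h1 := Finset.sum_range_succ
      (fun m => (T.cyclicPiece m).angleIn T.cuts T.orient comp) T.len
    have h2 := Finset.sum_range_succ'
      (fun m => (T.cyclicPiece m).angleIn T.cuts T.orient comp) T.len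
    have h3 := T.cyclicPiece_add_len 0
    rw [zero_add] at h3
    rw [h3] at h1
    linarith
  have hR : T.turningTo T.len =
      ∑ m ∈ Finset.range T.len, T.pieceTurning comp (T.cyclicPiece m) := by
    simp only [turningTo, hx, pieceTurning, Finset.sum_add_distrib, cyclicDrawn, hshift, add_assoc]
  rw [hR, ← Fin.sum_univ_eq_sum_range]
  simp only [cyclicPiece_val]

/-- The boundary of the cut surface has odd rotation number. -/
theorem exists_odd_turningTo_len : ∃ R : ℤ, Odd R ∧ T.turningTo T.len = 2 * Real.pi * R := by
  classical
  obtain ⟨comp, hs, hf, h1, h2⟩ := T.exists_cut_components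
  -- Indicator form of the two kinds of pieces, so that after exchanging sums each circle and each
  -- side of a cut is collected separately.
  have hdecomp : ∀ p : BoundaryPiece D, T.pieceTurning comp p =
      ∑ c : D.Component, ((T.orient : ℤ) : ℝ) * c.sign * p.lengthOn c +
      ∑ k, ∑ rev, if p = .cut k rev then T.pieceTurning comp (.cut k rev) else 0 := by
    intro p
    cases p with
    | arc c a ℓ hℓ =>
      simp [pieceTurning, BoundaryPiece.drawn, BoundaryPiece.angleIn, BoundaryPiece.angleOut,
        pathTurning, circleArc_turning, BoundaryPiece.lengthOn]
    | cut k rev =>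
      have : ∀ k' rev', (BoundaryPiece.cut k rev : BoundaryPiece D) = .cut k' rev' ↔
          k = k' ∧ rev = rev' := by simp
      simp only [BoundaryPiece.lengthOn, this]
      rw [Finset.sum_eq_single k (by
        intro b _ hb
        simp [hb.symm]) (by simp), Finset.sum_eq_single rev (by
        intro b _ hb
        simp [hb.symm]) (by simp)]
      simp
  have hcut : ∀ k rev, (∑ m, if T.piece m = .cut k rev then T.pieceTurning comp (.cut k rev)
      else 0) = T.pieceTurning comp (.cut k rev) := by
    intro k rev
    obtain ⟨m, hm, huniq⟩ := T.cut_once k rev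
    rw [Finset.sum_eq_single m, if_pos hm]
    · intro m' _ hne
      exact if_neg fun h => hne (huniq m' h)
    · simp
  have hodd : ∀ c : D.Component, ∃ n : ℤ, ((T.orient : ℤ) : ℝ) * c.sign = 2 * n + 1 := by
    intro c
    rcases orient_mul_sign_eq T.orient c with h | h
    · exact ⟨0, by simp [h]⟩
    · exact ⟨-1, by rw [h]; norm_num⟩
  choose n hn using hodd
  obtain ⟨o, ho⟩ : ∃ o : ℤ, (T.orient : ℤ) = 2 * o + 1 := by
    rcases Int.units_eq_one_or T.orient with h | h
    · exact ⟨0, by simp [h]⟩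
    · exact ⟨-1, by simp [h]⟩
  have hsum : T.turningTo T.len = ∑ c : D.Component, (2 * (n c : ℝ) + 1) * (2 * Real.pi) +
      ∑ k, 2 * Real.pi * ((2 * (o : ℝ) + 1) - 2 * ((T.cuts k).num : ℝ)) := by
    rw [T.turningTo_len_eq hs hf, Finset.sum_congr rfl fun m _ => hdecomp (T.piece m),
      Finset.sum_add_distrib]
    congr 1
    · rw [Finset.sum_comm]
      exact Finset.sum_congr rfl fun c _ => by rw [← Finset.mul_sum, T.sum_lengthOn, hn]
    · rw [Finset.sum_comm]
      refine Finset.sum_congr rfl fun k _ => ?_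
      rw [Finset.sum_comm, Finset.sum_congr rfl fun rev _ => hcut k rev, Fintype.sum_bool,
        add_comm, T.pieceTurning_cut_add_reverse k (h1 k) (h2 k), ho]
      push_cast
      ring
  have hb := D.numComponents_pos
  -- The odd units, one per circle and one per cut, number `b + (b - 1) = 2(b - 1) + 1`.
  refine ⟨2 * (∑ c, n c + ∑ k, (o - (T.cuts k).num) + D.numComponents - 1) + 1, ⟨_, rfl⟩, ?_⟩
  rw [hsum, ← Finset.sum_mul, ← Finset.mul_sum]
  simp only [Finset.sum_add_distrib, Finset.sum_sub_distrib, ← Finset.mul_sum]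
  simp only [Finset.sum_const, Finset.card_univ, Fintype.card_fin, card_component, nsmul_eq_mul]
  push_cast
  rw [Nat.cast_sub hb]
  push_cast
  ring

end CutSurface

/-! ### Degrees of the vertices of a perfectly oriented network -/

namespace Network

variable {D : PuncturedPolygon} {V E : Type*} [Finite E] {N : Network D V E}

theorem inDegree_pos (e : E) : 0 < N.inDegree (N.tgt e) :=
  (Set.ncard_pos (Set.toFinite _)).mpr ⟨e, rfl⟩

theorem outDegree_pos (e : E) : 0 < N.outDegree (N.src e) :=
  (Set.ncard_pos (Set.toFinite _)).mpr ⟨e, rfl⟩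

/-- Paths do not pass through boundary vertices. -/
theorem PerfectlyOriented.not_mem_K (hN : N.PerfectlyOriented) {e f : E}
    (h : N.tgt e = N.src f) : N.src f ∉ N.K := by
  intro hK
  have h1 := hN.1 _ hK
  have h2 := outDegree_pos (N := N) f
  have h3 := inDegree_pos (N := N) e
  rw [h] at h3
  omega

end Network

/-! ### Lifted angles and the rotation numbers of the curves `C(P)` -/

namespace CutSurface

variable {D : PuncturedPolygon} {V E : Type*} {N : Network D V E} (T : CutSurface N)

/-- Shows that the initial argument plus the accumulated turning is a genuine lift of the boundary
direction at every piece. -/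
theorem exp_turningTo (n : ℕ) :
    Complex.exp ((((headVel (T.cyclicDrawn 0)).arg + T.turningTo n : ℝ) : ℂ) * Complex.I) =
      unitVec (headVel (T.cyclicDrawn n)) := by
  induction n with
  | zero => simp [turningTo, exp_arg_eq_unitVec (headVel_ne_zero _)]
  | succ n ih =>
    have h1 := unitVec_ne_zero (headVel_ne_zero (T.cyclicDrawn n))
    have h2 := unitVec_ne_zero (lastVel_ne_zero (T.cyclicDrawn n))
    rw [turningTo_succ, ← add_assoc, ← add_assoc]
    rw [Complex.ofReal_add, Complex.ofReal_add, add_mul, add_mul, Complex.exp_add,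
      Complex.exp_add, ih, exp_pathTurning (T.cyclicDrawn_ne_nil n), corner,
      exp_arg_div (headVel_ne_zero _) (lastVel_ne_zero _)]
    field_simp

/-- The angle of the tangent of the boundary where it reaches the piece number `p`. -/
noncomputable def angleBefore (p : ℕ) : ℝ :=
  (headVel (T.cyclicDrawn 0)).arg + T.turningTo p - T.corner (p + (T.len - 1))

/-- The angle of the tangent of the boundary at the start of the piece number `p`. -/
noncomputable def angleAfter (p : ℕ) : ℝ := (headVel (T.cyclicDrawn 0)).arg + T.turningTo p

/-- The cyclic predecessor of piece `p` is written `p + (len - 1)` to avoid truncated subtraction at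
`p = 0`. -/
theorem headVel_add_len (p : ℕ) :
    headVel (T.cyclicDrawn (p + (T.len - 1) + 1)) = headVel (T.cyclicDrawn p) := by
  have := T.len_pos
  rw [show p + (T.len - 1) + 1 = p + T.len by omega, cyclicDrawn, cyclicPiece_add_len]
  rfl

theorem exp_angleBefore (p : ℕ) :
    Complex.exp (T.angleBefore p * Complex.I) =
      unitVec (lastVel (T.cyclicDrawn (p + (T.len - 1)))) := by
  have h1 := unitVec_ne_zero (headVel_ne_zero (T.cyclicDrawn p))
  rw [angleBefore, Complex.ofReal_sub, sub_mul, Complex.exp_sub, exp_turningTo, corner,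
    headVel_add_len, exp_arg_div (headVel_ne_zero _) (lastVel_ne_zero _)]
  field_simp

/-- Angles of the directions of the edges at their ends which are compatible with the exterior
angles at all vertices. -/
theorem exists_edge_angles [Finite E] (hN : N.PerfectlyOriented) : ∃ αs αf : E → ℝ,
    (∀ e, Complex.exp (αs e * Complex.I) = unitVec (N.curve e).startDir) ∧
    (∀ e, Complex.exp (αf e * Complex.I) = unitVec (N.curve e).finishDir) ∧
    (∀ e f, N.tgt e = N.src f →
      ((N.curve f).startDir / (N.curve e).finishDir).arg = αs f - αf e) ∧
    (∀ (i : N.K) e, N.src e = i → αs e = T.angleBefore (T.place i) + ((N.curve e).startDir /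
      lastVel (T.cyclicDrawn (T.place i + (T.len - 1)))).arg) ∧
    (∀ (j : N.K) e, N.tgt e = j → αf e = T.angleAfter (T.place j) -
      (headVel (T.cyclicDrawn (T.place j)) / (N.curve e).finishDir).arg) := by
  have hu (c : D.Curve) := unitVec_ne_zero c.startDir_ne_zero
  have hu' (c : D.Curve) := unitVec_ne_zero c.finishDir_ne_zero
  have key : ∀ v : V, ∃ s f : E → ℝ,
      (∀ e, Complex.exp (s e * Complex.I) = unitVec (N.curve e).startDir) ∧
      (∀ e, Complex.exp (f e * Complex.I) = unitVec (N.curve e).finishDir) ∧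
      (∀ e e', N.tgt e = v → N.src e' = v →
        ((N.curve e').startDir / (N.curve e).finishDir).arg = s e' - f e) ∧
      ∀ hv : v ∈ N.K,
        (∀ e, s e = T.angleBefore (T.place ⟨v, hv⟩) + ((N.curve e).startDir /
          lastVel (T.cyclicDrawn (T.place ⟨v, hv⟩ + (T.len - 1)))).arg) ∧
        (∀ e, f e = T.angleAfter (T.place ⟨v, hv⟩) -
          (headVel (T.cyclicDrawn (T.place ⟨v, hv⟩)) / (N.curve e).finishDir).arg) := by
    intro v
    by_cases hv : v ∈ N.K
    -- The closed curve arrives at a source along `∂T` and leaves a sink along `∂T`. The lifts are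
    -- therefore tied to the incoming boundary angle for departing edges and to the outgoing one for
    -- arriving edges.
    · refine ⟨fun e => T.angleBefore (T.place ⟨v, hv⟩) + ((N.curve e).startDir /
          lastVel (T.cyclicDrawn (T.place ⟨v, hv⟩ + (T.len - 1)))).arg,
        fun e => T.angleAfter (T.place ⟨v, hv⟩) -
          (headVel (T.cyclicDrawn (T.place ⟨v, hv⟩)) / (N.curve e).finishDir).arg,
        ?_, ?_, ?_, fun _ => ⟨fun _ => rfl, fun _ => rfl⟩⟩
      · intro e
        have h1 := unitVec_ne_zero
          (lastVel_ne_zero (T.cyclicDrawn (T.place ⟨v, hv⟩ + (T.len - 1))))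
        rw [Complex.ofReal_add, add_mul, Complex.exp_add, exp_angleBefore,
          exp_arg_div (Curve.startDir_ne_zero _) (lastVel_ne_zero _)]
        field_simp
      · intro e
        have h1 := unitVec_ne_zero (headVel_ne_zero (T.cyclicDrawn (T.place ⟨v, hv⟩)))
        have h2 := hu' (N.curve e)
        rw [Complex.ofReal_sub, sub_mul, Complex.exp_sub, angleAfter, exp_turningTo,
          exp_arg_div (headVel_ne_zero _) (Curve.finishDir_ne_zero _)]
        field_simp
      · intro e e' he he'
        exact absurd (he' ▸ hv) (hN.not_mem_K (he.trans he'.symm))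
    · obtain ⟨h3, h0, h0'⟩ := hN.2 v hv
      -- With two incoming and two outgoing edges, four prescribed differences would overdetermine
      -- the lifts; a unique edge on one side removes the conflict. Its lift is taken as reference
      -- for the edges on the other side.
      have h1 : N.inDegree v = 1 ∨ N.outDegree v = 1 := by omega
      rcases h1 with h1 | h1
      · obtain ⟨e₀, he₀⟩ := Set.ncard_eq_one.mp h1
        refine ⟨fun e => (N.curve e₀).finishDir.arg +
          ((N.curve e).startDir / (N.curve e₀).finishDir).arg,
          fun e => (N.curve e).finishDir.arg, ?_, ?_, ?_, fun h => absurd h hv⟩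
        · intro e
          have := hu' (N.curve e₀)
          rw [Complex.ofReal_add, add_mul, Complex.exp_add,
            exp_arg_eq_unitVec (Curve.finishDir_ne_zero _),
            exp_arg_div (Curve.startDir_ne_zero _) (Curve.finishDir_ne_zero _)]
          field_simp
        · exact fun e => exp_arg_eq_unitVec (Curve.finishDir_ne_zero _)
        · intro e e' he _
          obtain rfl : e = e₀ := by
            have : e ∈ {e | N.tgt e = v} := he
            rwa [he₀] at this
          ring
      · obtain ⟨e₀, he₀⟩ := Set.ncard_eq_one.mp h1
        refine ⟨fun e => (N.curve e).startDir.arg, fun e => (N.curve e₀).startDir.arg -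
          ((N.curve e₀).startDir / (N.curve e).finishDir).arg, ?_, ?_, ?_, fun h => absurd h hv⟩
        · exact fun e => exp_arg_eq_unitVec (Curve.startDir_ne_zero _)
        · intro e
          have := hu (N.curve e₀)
          have := hu' (N.curve e)
          rw [Complex.ofReal_sub, sub_mul, Complex.exp_sub,
            exp_arg_eq_unitVec (Curve.startDir_ne_zero _),
            exp_arg_div (Curve.startDir_ne_zero _) (Curve.finishDir_ne_zero _)]
          field_simp
        · intro e e' _ he'
          obtain rfl : e' = e₀ := by
            have : e' ∈ {e | N.src e = v} := he'
            rwa [he₀] at this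
          ring
  choose s f h1 h2 h3 h4 using key
  -- The lifts at the two ends of an edge are independent, so the choices made at different vertices
  -- do not interact.
  refine ⟨fun e => s (N.src e) e, fun e => f (N.tgt e) e, fun e => h1 _ e, fun e => h2 _ e,
    ?_, ?_, ?_⟩
  · intro e e' h
    simp only [h3 (N.src e') e e' h rfl, h]
  · rintro ⟨i, hi⟩ e rfl
    exact (h4 _ hi).1 e
  · rintro ⟨j, hj⟩ e rfl
    exact (h4 _ hj).2 e

/-- The turning of the drawn edge and the difference of its end lifts have the same exponential. -/
theorem exists_edge_integers {αs αf : E → ℝ}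
    (hs : ∀ e, Complex.exp (αs e * Complex.I) = unitVec (N.curve e).startDir)
    (hf : ∀ e, Complex.exp (αf e * Complex.I) = unitVec (N.curve e).finishDir) :
    ∃ n : E → ℤ, ∀ e, pathTurning (N.curve e).drawn = αf e - αs e + 2 * Real.pi * n e := by
  have key : ∀ e, ∃ n : ℤ,
      pathTurning (N.curve e).drawn = αf e - αs e + 2 * Real.pi * n := by
    intro e
    have h1 := exp_pathTurning (N.curve e).drawn_ne_nil
    rw [Curve.lastVel_drawn, Curve.headVel_drawn, ← hs, ← hf, ← Complex.exp_sub] at h1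
    obtain ⟨n, hn⟩ := Complex.exp_eq_exp_iff_exists_int.mp h1
    refine ⟨n, ?_⟩
    have : (pathTurning (N.curve e).drawn : ℂ) = αf e - αs e + 2 * Real.pi * n := by
      apply mul_right_cancel₀ Complex.I_ne_zero
      rw [hn]; ring
    exact_mod_cast this
  choose n hn using key
  exact ⟨n, hn⟩

/-- The turning along a nonempty path. -/
theorem pathTurning_path {αs αf : E → ℝ} {n : E → ℤ}
    (hv : ∀ e f, N.tgt e = N.src f →
      ((N.curve f).startDir / (N.curve e).finishDir).arg = αs f - αf e)
    (hn : ∀ e, pathTurning (N.curve e).drawn = αf e - αs e + 2 * Real.pi * n e)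
    (P : List E) (e : E) (i j : V) (hP : N.IsPath i (e :: P) j) :
    ∃ f, N.tgt f = j ∧
      lastVel ((e :: P).flatMap fun e => (N.curve e).drawn) = (N.curve f).finishDir ∧
      headVel ((e :: P).flatMap fun e => (N.curve e).drawn) = (N.curve e).startDir ∧
      pathTurning ((e :: P).flatMap fun e => (N.curve e).drawn) =
        αf f - αs e + 2 * Real.pi * ((e :: P).map n).sum := by
  induction P generalizing e i with
  | nil =>
    refine ⟨e, hP.2, ?_, ?_, ?_⟩ <;>
      simp [Curve.lastVel_drawn, Curve.headVel_drawn, hn]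
  | cons f P ih =>
    obtain ⟨k, hk, h1, h2, h3⟩ := ih f _ hP.2
    have hne : ((f :: P).flatMap fun e => (N.curve e).drawn) ≠ [] := by
      simp [Curve.drawn_ne_nil]
    refine ⟨k, hk, ?_, ?_, ?_⟩
    · rw [List.flatMap_cons, lastVel_append _ hne, h1]
    · rw [List.flatMap_cons, headVel_append _ (Curve.drawn_ne_nil _), Curve.headVel_drawn]
    · rw [List.flatMap_cons, pathTurning_append (Curve.drawn_ne_nil _) hne, h2, h3,
        Curve.lastVel_drawn, hv e f hP.2.1.symm, hn]
      simp only [List.map_cons, List.sum_cons]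
      push_cast
      ring

/-- The turning along the boundary from `j` to `i`. -/
theorem pathTurning_boundaryFromTo (i j : N.K) :
    pathTurning (T.boundaryFromTo j i) = T.angleBefore (T.place i) - T.angleAfter (T.place j) +
      (if T.place j < T.place i then 0 else T.turningTo T.len) ∧
    headVel (T.boundaryFromTo j i) = headVel (T.cyclicDrawn (T.place j)) ∧
    lastVel (T.boundaryFromTo j i) = lastVel (T.cyclicDrawn (T.place i + (T.len - 1))) ∧
    T.boundaryFromTo j i ≠ [] := by
  have hi := (T.place i).2
  have hj := (T.place j).2
  -- Either the walk from `j` reaches `i` before the base point, or it ends at index `place i + len`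
  -- after passing it. The full circuit for `i = j` belongs to the second case.
  obtain ⟨n, hn, hcase⟩ : ∃ n, (if ((T.place i : ℕ) + T.len - T.place j) % T.len = 0 then T.len
      else ((T.place i : ℕ) + T.len - T.place j) % T.len) = n + 1 ∧
      ((T.place j < T.place i ∧ (T.place j : ℕ) + (n + 1) = T.place i) ∨
        (¬ T.place j < T.place i ∧ (T.place j : ℕ) + (n + 1) = T.place i + T.len)) := by
    simp only [Fin.lt_def]
    by_cases h : (T.place j : ℕ) < T.place i
    · have : ((T.place i : ℕ) + T.len - T.place j) % T.len = T.place i - T.place j := by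
        rw [Nat.mod_eq_sub_mod (by omega), Nat.mod_eq_of_lt (by omega)]
        omega
      rw [this, if_neg (by omega)]
      exact ⟨T.place i - T.place j - 1, by omega, Or.inl ⟨h, by omega⟩⟩
    · by_cases h' : (T.place j : ℕ) = T.place i
      · have : ((T.place i : ℕ) + T.len - T.place j) % T.len = 0 := by
          rw [h', Nat.add_sub_cancel_left, Nat.mod_self]
        rw [if_pos this]
        exact ⟨T.len - 1, by omega, Or.inr ⟨h, by omega⟩⟩
      · have : ((T.place i : ℕ) + T.len - T.place j) % T.len =
            T.place i + T.len - T.place j := Nat.mod_eq_of_lt (by omega)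
        rw [this, if_neg (by omega)]
        exact ⟨T.place i + T.len - T.place j - 1, by omega, Or.inr ⟨h, by omega⟩⟩
  have hB : T.boundaryFromTo j i =
      (List.range (n + 1)).flatMap fun m => T.cyclicDrawn (T.place j + m) := by
    rw [← hn]
    rfl
  obtain ⟨h1, h2, h3, h4⟩ := T.pathTurning_flatMap (T.place j) n
  rw [hB]
  refine ⟨?_, h2, ?_, h4⟩
  · rw [h1, angleBefore, angleAfter]
    rcases hcase with ⟨hlt, hc⟩ | ⟨hlt, hc⟩
    · rw [if_pos hlt, hc,
        show (T.place i : ℕ) + (T.len - 1) = T.place j + n + T.len by omega, corner_add_len]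
      ring
    · rw [if_neg hlt, hc, turningTo_add_len,
        show (T.place i : ℕ) + (T.len - 1) = T.place j + n by omega]
      ring
  · rw [h3]
    rcases hcase with ⟨hlt, hc⟩ | ⟨hlt, hc⟩
    · rw [show (T.place i : ℕ) + (T.len - 1) = T.place j + n + T.len by omega]
      simp only [cyclicDrawn, cyclicPiece_add_len]
    · rw [show (T.place i : ℕ) + (T.len - 1) = T.place j + n by omega]

theorem rotationNumber_eq {l : List PlanarArc} {r : ℤ} (h : totalTurning l = 2 * Real.pi * r) :
    rotationNumber l = r := by
  rw [totalTurning_eq_rotationNumber] at h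
  exact_mod_cast mul_left_cancel₀ Real.two_pi_pos.ne' h

/-- For the empty path the curve is `∂T` itself, started elsewhere. -/
theorem rotationNumber_nil {R : ℤ} (hR : T.turningTo T.len = 2 * Real.pi * R) (i : N.K)
    (P : N.Path i i) (hP : P.1 = []) : rotationNumber (T.closedCurve i i P) = R := by
  obtain ⟨h1, h2, h3, h4⟩ := T.pathTurning_boundaryFromTo i i
  apply rotationNumber_eq
  rw [closedCurve, hP, List.flatMap_nil, List.nil_append, totalTurning_eq h4, h1, h2, h3,
    if_neg (lt_irrefl _), ← hR, angleBefore, angleAfter, corner, headVel_add_len]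
  ring

/-- The corners at `j` and `i` are built into the lifts there, so every lift cancels. Only the edge
integers survive, together with `R` if the base point of `∂T` is passed. -/
theorem rotationNumber_cons {αs αf : E → ℝ} {n : E → ℤ} {R : ℤ}
    (hR : T.turningTo T.len = 2 * Real.pi * R)
    (hv : ∀ e f, N.tgt e = N.src f →
      ((N.curve f).startDir / (N.curve e).finishDir).arg = αs f - αf e)
    (hs : ∀ (i : N.K) e, N.src e = i → αs e = T.angleBefore (T.place i) +
      ((N.curve e).startDir / lastVel (T.cyclicDrawn (T.place i + (T.len - 1)))).arg)
    (hf : ∀ (j : N.K) e, N.tgt e = j → αf e = T.angleAfter (T.place j) -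
      (headVel (T.cyclicDrawn (T.place j)) / (N.curve e).finishDir).arg)
    (hn : ∀ e, pathTurning (N.curve e).drawn = αf e - αs e + 2 * Real.pi * n e)
    (i j : N.K) (P : N.Path i j) (hP : P.1 ≠ []) :
    rotationNumber (T.closedCurve i j P) =
      (P.1.map n).sum + if T.place j < T.place i then 0 else R := by
  obtain ⟨P, hPath⟩ := P
  cases P with
  | nil => exact absurd rfl hP
  | cons e P =>
    obtain ⟨f, hfj, h1, h2, h3⟩ := pathTurning_path hv hn P e i j hPath
    obtain ⟨g1, g2, g3, g4⟩ := T.pathTurning_boundaryFromTo i j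
    have hne : ((e :: P).flatMap fun e => (N.curve e).drawn) ≠ [] := by
      simp [Curve.drawn_ne_nil]
    apply rotationNumber_eq
    change totalTurning ((e :: P).flatMap (fun e => (N.curve e).drawn) ++ T.boundaryFromTo j i) = _
    rw [totalTurning_eq (by simp [g4]), pathTurning_append hne g4,
      headVel_append _ hne, lastVel_append _ g4, h1, h2, h3, g1, g2, g3, hR, hs i e hPath.1,
      hf j f hfj]
    split_ifs <;> push_cast <;> ring

/-! ### Counting boundary sources -/

theorem place_injective : Function.Injective T.place := by
  intro v w h
  have h1 := T.place_start v
  rw [h, T.place_start w] at h1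
  exact Subtype.ext (N.pos_injective h1.symm)

/-- The number of boundary sources before a boundary vertex. -/
noncomputable def sourcesBefore (v : N.K) : ℕ :=
  {k : N.K | k.1 ∈ N.I ∧ T.place k < T.place v}.ncard

/-- The source `i` precedes `j` but is neither before itself nor strictly between, which accounts
for the extra `1`. -/
theorem sourcesBefore_of_lt [Finite V] {i j : N.K} (hi : i.1 ∈ N.I)
    (h : T.place i < T.place j) :
    T.sourcesBefore j = T.sourcesBefore i + 1 + T.between i j := by
  have hset : {k : N.K | k.1 ∈ N.I ∧ T.place k < T.place j} =
      insert i {k : N.K | k.1 ∈ N.I ∧ T.place k < T.place i} ∪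
      {k : N.K | k.1 ∈ N.I ∧ ((T.place i < T.place k ∧ T.place k < T.place j) ∨
        (T.place j < T.place k ∧ T.place k < T.place i))} := by
    ext k
    simp only [mem_ofPred_eq, mem_union, mem_insert_iff]
    constructor
    · rintro ⟨hk, hlt⟩
      rcases lt_trichotomy (T.place k) (T.place i) with h' | h' | h'
      · exact Or.inl (Or.inr ⟨hk, h'⟩)
      · exact Or.inl (Or.inl (T.place_injective h'))
      · exact Or.inr ⟨hk, Or.inl ⟨h', hlt⟩⟩
    · rintro ((rfl | ⟨hk, h'⟩) | ⟨hk, ⟨_, h'⟩ | ⟨h', h''⟩⟩)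
      · exact ⟨hi, h⟩
      · exact ⟨hk, h'.trans h⟩
      · exact ⟨hk, h'⟩
      · exact absurd (h.trans h') (not_lt_of_gt h'')
  rw [sourcesBefore, hset, Set.ncard_union_eq, Set.ncard_insert_of_notMem (by simp)]
  · rfl
  · refine Set.disjoint_left.mpr ?_
    rintro k (rfl | ⟨_, h1⟩) ⟨_, ⟨h2, h3⟩ | ⟨h2, h3⟩⟩
    · exact lt_irrefl _ h2
    · exact lt_irrefl _ h3
    · exact lt_asymm h1 h2
    · exact lt_asymm h (h2.trans h3)

/-- No extra `1` here: the earlier vertex `j` is not a source. This asymmetry is what the odd `R`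
offsets. -/
theorem sourcesBefore_of_gt [Finite V] {i j : N.K} (hj : j.1 ∉ N.I)
    (h : T.place j < T.place i) :
    T.sourcesBefore i = T.sourcesBefore j + T.between i j := by
  have hset : {k : N.K | k.1 ∈ N.I ∧ T.place k < T.place i} =
      {k : N.K | k.1 ∈ N.I ∧ T.place k < T.place j} ∪
      {k : N.K | k.1 ∈ N.I ∧ ((T.place i < T.place k ∧ T.place k < T.place j) ∨
        (T.place j < T.place k ∧ T.place k < T.place i))} := by
    ext k
    simp only [mem_ofPred_eq, mem_union]
    constructor
    · rintro ⟨hk, hlt⟩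
      rcases lt_trichotomy (T.place k) (T.place j) with h' | h' | h'
      · exact Or.inl ⟨hk, h'⟩
      · exact absurd (T.place_injective h' ▸ hk) hj
      · exact Or.inr ⟨hk, Or.inr ⟨h', hlt⟩⟩
    · rintro (⟨hk, h'⟩ | ⟨hk, ⟨h', h''⟩ | ⟨_, h'⟩⟩)
      · exact ⟨hk, h'.trans h⟩
      · exact absurd (h.trans h') (not_lt_of_gt h'')
      · exact ⟨hk, h'⟩
  rw [sourcesBefore, hset, Set.ncard_union_eq]
  · rfl
  · refine Set.disjoint_left.mpr ?_
    rintro k ⟨_, h1⟩ ⟨_, ⟨h2, h3⟩ | ⟨h2, h3⟩⟩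
    · exact lt_asymm h (h2.trans h1)
    · exact lt_asymm h1 h2

theorem between_self (i : N.K) : T.between i i = 0 := by
  have : {k : N.K | k.1 ∈ N.I ∧ ((T.place i < T.place k ∧ T.place k < T.place i) ∨
      (T.place i < T.place k ∧ T.place k < T.place i))} = ∅ := by
    ext k
    simp only [mem_ofPred_eq, mem_empty_iff_false, iff_false]
    rintro ⟨_, ⟨h, h'⟩ | ⟨h, h'⟩⟩ <;> exact lt_asymm h h'
  rw [between, this, Set.ncard_empty]

end CutSurface

/-! ### Edge signs and the boundary measurement matrix -/

theorem neg_one_zpow_congr {a b : ℤ} (h : Even (a - b)) : (-1 : ℝ) ^ a = (-1) ^ b := by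
  obtain ⟨c, hc⟩ := h
  obtain rfl : a = b + 2 * c := by linarith
  rw [zpow_add₀ (by norm_num), zpow_mul]
  norm_num

namespace Network

variable {D : PuncturedPolygon} {V E : Type*} {N : Network D V E}

/-- Edge signs which change only at the boundary multiply along a path to the signs at its ends. -/
theorem prod_signs [Finite E] (hN : N.PerfectlyOriented) (n : E → ℤ) (u w : V → ℤ)
    (hu : ∀ v ∉ N.K, u v = 0) (hw : ∀ v ∉ N.K, w v = 0) (P : List E) (e : E) (i j : V)
    (hP : N.IsPath i (e :: P) j) :
    ((e :: P).map fun e => (-1 : ℝ) ^ (n e + u (N.src e) + w (N.tgt e))).prod =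
      (-1) ^ (((e :: P).map n).sum + u i + w j) := by
  induction P generalizing e i with
  | nil =>
    obtain ⟨rfl, rfl⟩ := hP
    simp
  | cons f P ih =>
    obtain ⟨rfl, hP⟩ := hP
    have hf : N.tgt e = N.src f := hP.1.symm
    have hK := hN.not_mem_K hf
    rw [List.map_cons, List.prod_cons, ih f _ hP, ← zpow_add₀ (by norm_num), hf, hu _ hK, hw _ hK]
    simp only [List.map_cons, List.sum_cons]
    ring_nf

theorem IsPath.exists_tgt {P : List E} {i j : V} (hP : N.IsPath i P j) (hne : P ≠ []) :
    ∃ e, N.tgt e = j := by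
  induction P generalizing i with
  | nil => exact absurd rfl hne
  | cons e P ih =>
    cases P with
    | nil => exact ⟨e, hP.2⟩
    | cons f P => exact ih hP.2 (by simp)

theorem Path.wt_C_mul {i j : V} (P : N.Path i j) (ε : E → ℝ) (y : E → MvPowerSeries E ℝ) :
    P.wt (fun e => MvPowerSeries.C (ε e) * y e) = (P.1.map ε).prod • P.wt y := by
  rw [MvPowerSeries.smul_eq_C_mul, wt, wt, List.prod_map_mul, map_list_prod, List.map_map]
  rfl

end Network

/-- For perfectly oriented networks, the signs in the boundary measurement matrix come from signs
of the edges. -/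
theorem CutSurface.exists_signs {D : PuncturedPolygon} {V E : Type*} [Finite V] [Finite E]
    {N : Network D V E} (hN : N.PerfectlyOriented) (T : CutSurface N) :
    ∃ ε : E → ℝ, (∀ e, ε e = 1 ∨ ε e = -1) ∧
      ∀ (i j : N.K) (P : N.Path i j), i.1 ∈ N.I →
        (-1 : ℝ) ^ ((T.between i j : ℤ) + rotationNumber (T.closedCurve i j P) + 1) =
          (P.1.map ε).prod := by
  classical
  obtain ⟨R, hRodd, hR⟩ := T.exists_odd_turningTo_len
  obtain ⟨αs, αf, h1, h2, hv, hs, hf⟩ := T.exists_edge_angles hN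
  obtain ⟨n, hn⟩ := exists_edge_integers h1 h2
  -- The end contributions are `w` at the final vertex and `u` at the initial one; the `+ 1` in `u`
  -- is the `+ 1` of the exponent in `B`. Both vanish at interior vertices, so only the two ends of
  -- a path see them.
  let w : V → ℤ := fun v => if hv : v ∈ N.K then T.sourcesBefore ⟨v, hv⟩ else 0
  let u : V → ℤ := fun v => if hv : v ∈ N.K then T.sourcesBefore ⟨v, hv⟩ + 1 else 0
  have hw : ∀ v : N.K, w v = T.sourcesBefore v := fun v => dif_pos v.2
  have hu : ∀ v : N.K, u v = T.sourcesBefore v + 1 := fun v => dif_pos v.2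
  refine ⟨fun e => (-1) ^ (n e + u (N.src e) + w (N.tgt e)), fun e => ?_, ?_⟩
  · rcases Int.even_or_odd (n e + u (N.src e) + w (N.tgt e)) with h | h
    · exact Or.inl h.neg_one_zpow
    · exact Or.inr h.neg_one_zpow
  · rintro i j P hi
    by_cases hP : P.1 = []
    · obtain rfl : i = j := by
        have := P.2
        rw [hP] at this
        exact Subtype.ext this
      rw [T.rotationNumber_nil hR i P hP, T.between_self, hP]
      -- The empty product forces the sign `+1`, which holds because `R + 1` is even.
      simpa using (hRodd.add_one).neg_one_zpow
    · have hj : j.1 ∉ N.I := by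
        intro hj
        obtain ⟨e, he⟩ := P.2.exists_tgt hP
        exact hj.2 e he
      have hne : T.place i ≠ T.place j := fun h => hj (T.place_injective h ▸ hi)
      rw [T.rotationNumber_cons hR hv hs hf hn i j P hP]
      obtain ⟨P, hPath⟩ := P
      cases P with
      | nil => exact absurd rfl hP
      | cons e P =>
        rw [Network.prod_signs hN n u w (fun v h => dif_neg h) (fun v h => dif_neg h) P e i j
          hPath]
        apply neg_one_zpow_congr
        rw [hw, hu]
        obtain ⟨r, rfl⟩ := hRodd
        rcases lt_or_gt_of_ne hne with h | h
        · rw [if_neg (not_lt_of_gt h), T.sourcesBefore_of_lt hi h]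
          -- Here `R = 2r + 1` enters the exponent, and its odd part cancels the `1` counting the
          -- source `i`. The case `j < i` has neither term.
          exact ⟨r - T.sourcesBefore i, by push_cast; ring⟩
        · rw [if_pos h, T.sourcesBefore_of_gt hj h]
          exact ⟨-T.sourcesBefore j, by push_cast; ring⟩

theorem mainTheorem2 {V E : Type*} [Finite V] [Finite E] (D : PuncturedPolygon)
    (N : Network D V E) (hN : N.PerfectlyOriented) (T : CutSurface N) :
    ∃ ε : E → ℝ, (∀ e, ε e = 1 ∨ ε e = -1) ∧
      T.B (fun e => MvPowerSeries.X e) =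
        N.A (fun e => MvPowerSeries.C (ε e) * MvPowerSeries.X e) := by
  obtain ⟨ε, hε, h⟩ := T.exists_signs hN
  refine ⟨ε, hε, ?_⟩
  ext1 i j
  simp only [CutSurface.B, Network.A, Network.M, Matrix.of_apply, Matrix.submatrix_apply]
  -- The two series agree path by path, so convergence plays no role in the comparison.
  refine tsum_congr fun P => ?_
  rw [P.wt_C_mul, h ⟨i, i.2.1⟩ j P i.2]
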